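/- Let $\Sigma$ be the infinite trivalent planar lattice drawn as a brick wall (the honeycomb lattice): its vertex set is $V=\mathbb{Z}^2$, each $(i,j)$ is joined to $(i\pm1,j)$, and $(i,j)$ is joined to $(i,j+1)$ whenever $i+j$ is even. Its faces are the bricks: the face $f$ with lower left corner $(i,j)$, $i+j$ even, has the six vertices $\partial f=\{(i+k,j+l): k\in\{0,1,2\},\ l\in\{0,1\}\}$. The translations of $\Sigma$ are the translations by $t\in\mathbb{Z}^2$ with $t_1+t_2$ even. For finite $\Lambda\subset V$ let $\mathcal{A}(\Lambda)=\bigotimes_{v\in\Lambda}M_2(\mathbb{C})$, let $\mathcal{A}_{\rm loc}=\bigcup_{\Lambda}\mathcal{A}(\Lambda)$ under the inclusions $A\mapsto A\otimes\mathbb{1}$, and let the quasi-local algebra $\mathcal{A}$ be the norm completion of $\mathcal{A}_{\rm loc}$. For each face $f$ put $K_f=\bigotimes_{v\in\partial f}\sigma^{x}_v$ and $J_f=\bigotimes_{v\in\partial f}\sigma^{z}_v$. For finite $\Lambda$ let $H_\Lambda=-\sum_{f:\,\partial f\subset\Lambda}(K_f+J_f)$, and for $A\in\mathcal{A}_{\rm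 loc}$ let $\delta(A)=\lim_{\Lambda\uparrow V} i[H_\Lambda,A]$ (the net is eventually constant). A state on $\mathcal{A}$ is a linear functional $\omega$ with $\omega(A^*A)\ge 0$ for all $A\in\mathcal{A}$ and $\omega(\mathbb{1})=1$. A ground state is a state $\omega$ with $-i\,\omega(A^*\delta(A))\ge 0$ for all $A\in\mathcal{A}_{\rm loc}$. A state $\omega$ is pure if every positive linear functional $\varphi$ on $\mathcal{A}$ with $\omega-\varphi$ positive is a scalar multiple of $\omega$. **Theorem.** There is exactly one ground state $\omega_0$ on $\mathcal{A}$ that is invariant under all translations of $\Sigma$. It satisfies $\omega_0(K_f)=\omega_0(J_f)=1$ for every face $f$, it is the only state on $\mathcal{A}$ with this property, and it is a pure state. -/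

import Mathlib

open scoped ComplexOrder

noncomputable section

namespace ColorCode

/-! ### The lattice

The trivalent lattice is drawn as a brick wall: the vertices are the points of `ℤ × ℤ`,
`(i, j)` is joined to `(i ± 1, j)`, and `(i, j)` is joined to `(i, j + 1)` when `i + j` is even.
It is the honeycomb lattice; its faces are the bricks. -/

/-- The vertices of the lattice; each carries a qubit. -/
abbrev Site : Type := ℤ × ℤ

/-- The faces of the lattice. A brick is recorded by its lower left corner `(i, j)`,
and `i + j` is even because a vertical edge leaves that corner upwards. -/
abbrev Face : Type := {c : ℤ × ℤ // Even (c.1 + c.2)}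

/-- The six vertices of a face. -/
def Face.vertices (f : Face) : Finset Site :=
  {(f.1.1, f.1.2), (f.1.1 + 1, f.1.2), (f.1.1 + 2, f.1.2),
    (f.1.1, f.1.2 + 1), (f.1.1 + 1, f.1.2 + 1), (f.1.1 + 2, f.1.2 + 1)}

/-- The translations of the plane that preserve the lattice. -/
abbrev LatticeTranslation : Type := {t : ℤ × ℤ // Even (t.1 + t.2)}

/-! ### The local matrix algebras -/

/-- The algebra `⊗_{v ∈ Λ} M₂(ℂ)` of observables of a finite region `Λ`, as matrices over the
product basis of `⊗_{v ∈ Λ} ℂ²`. -/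
abbrev LocalMatrix (Λ : Finset Site) : Type := Matrix (Λ → Fin 2) (Λ → Fin 2) ℂ

/-- The elementary tensor `⊗_{v ∈ Λ} σ_v` with the same factor `σ` at each site. -/
def tensorPower (Λ : Finset Site) (σ : Matrix (Fin 2) (Fin 2) ℂ) : LocalMatrix Λ :=
  Matrix.of fun x y => ∏ v, σ (x v) (y v)

/-- The Pauli matrix `σˣ`. -/
def pauliX : Matrix (Fin 2) (Fin 2) ℂ := !![0, 1; 1, 0]

/-- The Pauli matrix `σᶻ`. -/
def pauliZ : Matrix (Fin 2) (Fin 2) ℂ := !![1, 0; 0, -1]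

/-- The inclusion `A ↦ A ⊗ 1` of the matrices over `Λ₁` into the matrices over `Λ₂ ⊇ Λ₁`. -/
def extendMatrix {Λ₁ Λ₂ : Finset Site} (h : Λ₁ ⊆ Λ₂) (M : LocalMatrix Λ₁) : LocalMatrix Λ₂ :=
  open Classical in
  Matrix.of fun x y =>
    if ∀ v : Λ₂, v.1 ∉ Λ₁ → x v = y v then
      M (fun v => x ⟨v.1, h v.2⟩) (fun v => y ⟨v.1, h v.2⟩) else 0

/-! ### The Hilbert space on which the local observables are realized

Its orthonormal basis consists of the product vectors with all but finitely many spins up.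
Every local matrix algebra acts on it faithfully, hence isometrically (`localRep_injective`, `norm_localRep`),
compatibly with the inclusions `A ↦ A ⊗ 1` (`localRep_extendMatrix`). So the norm closure of the
union of the local algebras is the completed inductive limit of the matrix algebras. -/

/-- Configurations of spins with all but finitely many spins up (`0`). -/
abbrev Config : Type := Site →₀ Fin 2

/-- `ℓ²` over the configurations: the infinite tensor product of `ℂ²` along the vectors `|0⟩`. -/
abbrev SpinSpace : Type := lp (fun _ : Config => ℂ) 2

/-- The bounded operators on `SpinSpace`. -/
abbrev Op : Type := SpinSpace →L[ℂ] SpinSpace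

/-- The configuration that is `x` on `Λ` and `s` off `Λ`. -/
def splice (Λ : Finset Site) (x : Λ → Fin 2) (s : Config) : Config :=
  Finsupp.onFinset (s.support ∪ Λ) (fun v => if h : v ∈ Λ then x ⟨v, h⟩ else s v) (by
    intro v hv
    by_cases h : v ∈ Λ
    · simp [h]
    · simp only [h, dif_neg, not_false_eq_true] at hv
      simp [hv])

/-- The restriction of a configuration to `Λ`. -/
def restr (Λ : Finset Site) (s : Config) : Λ → Fin 2 := fun v => s v

theorem splice_apply (Λ : Finset Site) (x : Λ → Fin 2) (s : Config) (v : Site) :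
    splice Λ x s v = if h : v ∈ Λ then x ⟨v, h⟩ else s v := rfl

@[simp] theorem restr_splice (Λ : Finset Site) (x : Λ → Fin 2) (s : Config) :
    restr Λ (splice Λ x s) = x := by
  funext v
  simp [restr, splice_apply]

@[simp] theorem splice_splice (Λ : Finset Site) (x y : Λ → Fin 2) (s : Config) :
    splice Λ x (splice Λ y s) = splice Λ x s := by
  ext v
  by_cases h : v ∈ Λ <;> simp [splice_apply, h]

@[simp] theorem splice_restr (Λ : Finset Site) (s : Config) : splice Λ (restr Λ s) s = s := by
  ext v
  by_cases h : v ∈ Λ <;> simp [splice_apply, restr]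

/-- The action of a partial bijection `g` of the configurations on `ψ` is `ψ ∘ g`, extended by
zero. -/
def pullFun (g : Config ≃. Config) (ψ : Config → ℂ) : Config → ℂ := fun s => (g s).elim 0 ψ

theorem sum_pullFun_le (g : Config ≃. Config) (ψ : SpinSpace) (S : Finset Config) :
    ∑ s ∈ S, ‖pullFun g ψ s‖ ^ (2 : ENNReal).toReal ≤ ‖ψ‖ ^ (2 : ENNReal).toReal := by
  classical
  have h2 : (0 : ℝ) < (2 : ENNReal).toReal := by simp
  have key : ∑ s ∈ S, ‖pullFun g ψ s‖ ^ (2 : ENNReal).toReal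
      = ∑ t ∈ S.biUnion (fun s => (g s).toFinset), ‖ψ t‖ ^ (2 : ENNReal).toReal := by
    rw [Finset.sum_biUnion]
    · refine Finset.sum_congr rfl fun s _ => ?_
      cases hs : g s <;> simp [pullFun, hs]
    · intro a _ b _ hab
      rw [Function.onFun, Finset.disjoint_left]
      intro t ha hb
      rw [Option.mem_toFinset] at ha hb
      exact hab (g.inj ha hb)
  rw [key]
  exact lp.sum_rpow_le_norm_rpow h2 ψ _

/-- The partial isometry `ψ ↦ ψ ∘ g` of `SpinSpace`. -/
def pull (g : Config ≃. Config) : Op :=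
  LinearMap.mkContinuous
    { toFun := fun ψ => (⟨pullFun g ψ, memℓp_gen' (sum_pullFun_le g ψ)⟩ : SpinSpace)
      map_add' := by
        intro ψ φ
        ext s
        change pullFun g (⇑(ψ + φ)) s = pullFun g ψ s + pullFun g φ s
        unfold pullFun
        cases g s with
        | none => exact (add_zero (0 : ℂ)).symm
        | some t => rfl
      map_smul' := by
        intro c ψ
        ext s
        change pullFun g (⇑(c • ψ)) s = c • pullFun g ψ s
        unfold pullFun
        cases g s <;> simp }
    1 (by
      intro ψ
      rw [one_mul]
      exact lp.norm_le_of_forall_sum_le (by simp) (norm_nonneg _) (sum_pullFun_le g ψ))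

theorem pull_apply (g : Config ≃. Config) (ψ : SpinSpace) (s : Config) :
    pull g ψ s = (g s).elim 0 ψ := rfl

theorem star_pull (g : Config ≃. Config) : star (pull g) = pull g.symm := by
  classical
  have hs : ∀ s, pull g (lp.single 2 s (1 : ℂ)) = (g.symm s).elim 0 (fun t => lp.single 2 t 1) := by
    intro s
    ext t
    rw [pull_apply]
    cases hg : g.symm s with
    | none =>
      cases ht : g t with
      | none => simp
      | some u =>
        have : u ≠ s := by
          rintro rfl
          rw [(g.eq_some_iff).2 ht] at hg
          cases hg
        simp [this]
    | some r =>
      have hr := (g.eq_some_iff).1 hg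
      cases ht : g t with
      | none =>
        have : t ≠ r := by rintro rfl; rw [hr] at ht; cases ht
        simp [this]
      | some u =>
        by_cases htr : t = r
        · subst htr
          rw [hr] at ht
          cases ht
          simp
        · have : u ≠ s := by
            rintro rfl
            exact htr (g.inj ht hr)
          simp [this, htr]
  ext ψ s
  have h1 : inner ℂ (lp.single 2 s (1 : ℂ)) (star (pull g) ψ) = star (pull g) ψ s := by
    rw [lp.inner_single_left]; simp
  rw [← h1, ContinuousLinearMap.star_eq_adjoint, ContinuousLinearMap.adjoint_inner_right, hs,
    pull_apply]
  cases g.symm s with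
  | none => simp
  | some t =>
    simp only [Option.elim]
    rw [lp.inner_single_left]; simp

/-- The matrix unit `|x⟩⟨y|` on `Λ`, as a partial bijection of the configurations. -/
def unitPEquiv (Λ : Finset Site) (x y : Λ → Fin 2) : Config ≃. Config where
  toFun s := if restr Λ s = x then some (splice Λ y s) else none
  invFun s := if restr Λ s = y then some (splice Λ x s) else none
  inv := by
    intro s t
    constructor
    · intro h
      by_cases ht : restr Λ t = y
      · simp only [ht, if_true, Option.some.injEq] at h
        subst h
        subst ht
        simp
      · simp [ht] at h
    · intro h
      by_cases hs : restr Λ s = x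
      · simp only [hs, if_true, Option.some.injEq] at h
        subst h
        subst hs
        simp
      · simp [hs] at h

/-- The action `M ⊗ 1` of a local matrix on `SpinSpace`. -/
def localOp (Λ : Finset Site) (M : LocalMatrix Λ) : Op :=
  ∑ x, ∑ y, M x y • pull (unitPEquiv Λ x y)

theorem localOp_apply (Λ : Finset Site) (M : LocalMatrix Λ) (ψ : SpinSpace) (s : Config) :
    localOp Λ M ψ s = ∑ y, M (restr Λ s) y * ψ (splice Λ y s) := by
  classical
  have hp : ∀ x y, pull (unitPEquiv Λ x y) ψ s
      = if restr Λ s = x then ψ (splice Λ y s) else 0 := by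
    intro x y
    rw [pull_apply]
    change Option.elim (if restr Λ s = x then some (splice Λ y s) else none) 0 ψ = _
    split_ifs <;> rfl
  simp only [localOp, sum_apply, smul_apply,
    lp.coeFn_sum, Finset.sum_apply, lp.coeFn_smul, Pi.smul_apply, hp, smul_eq_mul]
  rw [Finset.sum_comm]
  refine Finset.sum_congr rfl fun y _ => ?_
  simp

/-- The action of the matrix algebra over `Λ` on `SpinSpace`, as a unital `*`-homomorphism. -/
def localRep (Λ : Finset Site) : LocalMatrix Λ →⋆ₐ[ℂ] Op where
  toFun := localOp Λ
  map_one' := by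
    ext ψ s
    rw [localOp_apply]
    simp [Matrix.one_apply]
  map_mul' M N := by
    ext ψ s
    rw [mul_apply_eq_comp, localOp_apply, localOp_apply]
    simp only [localOp_apply, restr_splice, splice_splice, Matrix.mul_apply, Finset.sum_mul,
      Finset.mul_sum]
    rw [Finset.sum_comm]
    simp only [mul_assoc]
  map_zero' := by simp [localOp]
  map_add' M N := by simp [localOp, add_smul, Finset.sum_add_distrib]
  commutes' c := by
    ext ψ s
    rw [localOp_apply]
    simp [Matrix.algebraMap_matrix_apply, Algebra.algebraMap_eq_smul_one]
  map_star' M := by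
    simp only [localOp, star_sum, star_smul, star_pull]
    rw [Finset.sum_comm]
    rfl

theorem localRep_apply (Λ : Finset Site) (M : LocalMatrix Λ) (ψ : SpinSpace) (s : Config) :
    localRep Λ M ψ s = ∑ y, M (restr Λ s) y * ψ (splice Λ y s) :=
  localOp_apply Λ M ψ s

theorem localRep_injective (Λ : Finset Site) : Function.Injective (localRep Λ) := by
  classical
  intro M N h
  ext x y
  have hM : ∀ M : LocalMatrix Λ,
      localRep Λ M (lp.single 2 (splice Λ y 0) (1 : ℂ)) (splice Λ x 0) = M x y := by
    intro M
    rw [localRep_apply]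
    have : ∀ z, splice Λ z (0 : Config) = splice Λ y 0 ↔ z = y := fun z =>
      ⟨fun hz => by simpa using congrArg (restr Λ) hz, fun hz => by rw [hz]⟩
    simp [Pi.single_apply, this]
  rw [← hM M, ← hM N, h]

open scoped Matrix.Norms.L2Operator in
theorem norm_localRep (Λ : Finset Site) (M : LocalMatrix Λ) : ‖localRep Λ M‖ = ‖M‖ := by
  have hc : IsClosed ((localRep Λ).range : Set Op) :=
    ((localRep Λ).toAlgHom.toLinearMap.range).closed_of_finiteDimensional
  let _ := StarSubalgebra.cstarAlgebra (localRep Λ).range (h_closed := hc)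
  exact StarAlgEquiv.norm_map (StarAlgEquiv.ofInjective (localRep Λ) (localRep_injective Λ)) M

theorem localRep_extendMatrix {Λ₁ Λ₂ : Finset Site} (h : Λ₁ ⊆ Λ₂) (M : LocalMatrix Λ₁) :
    localRep Λ₂ (extendMatrix h M) = localRep Λ₁ M := by
  classical
  ext ψ s
  rw [localRep_apply, localRep_apply]
  symm
  refine Finset.sum_of_injOn (fun y v => if hv : v.1 ∈ Λ₁ then y ⟨v.1, hv⟩ else s v) ?_ ?_ ?_ ?_
  · intro y _ z _ hyz
    funext v
    have := congrFun hyz ⟨v.1, h v.2⟩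
    simpa using this
  · intro y _
    simp
  · intro y _ hy
    have : ¬ ∀ v : Λ₂, v.1 ∉ Λ₁ → restr Λ₂ s v = y v := by
      intro hall
      apply hy
      refine ⟨fun v => y ⟨v.1, h v.2⟩, by simp, ?_⟩
      funext v
      by_cases hv : v.1 ∈ Λ₁
      · simp [hv]
      · simpa [hv, restr] using hall v hv
    simp only [extendMatrix, Matrix.of_apply]
    rw [if_neg this, zero_mul]
  · intro y _
    have h1 : ∀ v : Λ₂, v.1 ∉ Λ₁ →
        restr Λ₂ s v = if hv : v.1 ∈ Λ₁ then y ⟨v.1, hv⟩ else s v := by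
      intro v hv
      simp [hv, restr]
    have h2 : splice Λ₂ (fun v => if hv : v.1 ∈ Λ₁ then y ⟨v.1, hv⟩ else s v) s
        = splice Λ₁ y s := by
      ext v
      by_cases hv : v ∈ Λ₁
      · simp [splice_apply, hv, h hv]
      · by_cases hv2 : v ∈ Λ₂ <;> simp [splice_apply, hv]
    rw [h2]
    simp only [extendMatrix, Matrix.of_apply]
    rw [if_pos h1]
    congr 2
    funext v
    simp

/-! ### The quasi-local algebra -/

/-- The algebra `𝒜(Λ)` of observables localized in the finite region `Λ`. -/
def localAlgebra (Λ : Finset Site) : StarSubalgebra ℂ Op := (localRep Λ).range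

theorem localAlgebra_mono {Λ₁ Λ₂ : Finset Site} (h : Λ₁ ⊆ Λ₂) :
    localAlgebra Λ₁ ≤ localAlgebra Λ₂ := by
  rintro _ ⟨M, rfl⟩
  exact ⟨extendMatrix h M, localRep_extendMatrix h M⟩

/-- The algebra `𝒜_loc` of local observables, the union of all `𝒜(Λ)` with `Λ` finite. -/
def localObservables : StarSubalgebra ℂ Op where
  carrier := ⋃ Λ : Finset Site, (localAlgebra Λ : Set Op)
  mul_mem' := by
    classical
    intro A B hA hB
    obtain ⟨Λ₁, hA⟩ := Set.mem_iUnion.1 hA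
    obtain ⟨Λ₂, hB⟩ := Set.mem_iUnion.1 hB
    exact Set.mem_iUnion.2 ⟨Λ₁ ∪ Λ₂, mul_mem (localAlgebra_mono Finset.subset_union_left hA)
      (localAlgebra_mono Finset.subset_union_right hB)⟩
  add_mem' := by
    classical
    intro A B hA hB
    obtain ⟨Λ₁, hA⟩ := Set.mem_iUnion.1 hA
    obtain ⟨Λ₂, hB⟩ := Set.mem_iUnion.1 hB
    exact Set.mem_iUnion.2 ⟨Λ₁ ∪ Λ₂, add_mem (localAlgebra_mono Finset.subset_union_left hA)
      (localAlgebra_mono Finset.subset_union_right hB)⟩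
  algebraMap_mem' c := Set.mem_iUnion.2 ⟨∅, algebraMap_mem _ c⟩
  star_mem' := by
    intro A hA
    obtain ⟨Λ, hA⟩ := Set.mem_iUnion.1 hA
    exact Set.mem_iUnion.2 ⟨Λ, star_mem hA⟩

/-- The quasi-local algebra `𝒜`, the norm closure of `𝒜_loc`. -/
def quasiLocal : StarSubalgebra ℂ Op := localObservables.topologicalClosure

/-- The quasi-local algebra as a type; it is a unital C*-algebra. -/
abbrev QLA : Type := quasiLocal

theorem localRep_mem_quasiLocal (Λ : Finset Site) (M : LocalMatrix Λ) :
    localRep Λ M ∈ quasiLocal :=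
  localObservables.le_topologicalClosure (Set.mem_iUnion.2 ⟨Λ, M, rfl⟩)

/-- The element of the quasi-local algebra given by a local matrix. -/
def toQLA (Λ : Finset Site) (M : LocalMatrix Λ) : QLA :=
  ⟨localRep Λ M, localRep_mem_quasiLocal Λ M⟩

/-! ### Translations -/

/-- The translation of configurations by `t`: the spin at `v` is moved to `v + t`. -/
def shift (t : Site) : Config ≃ Config := Finsupp.equivCongrLeft (Equiv.addRight t)

theorem shift_apply (t : Site) (s : Config) (v : Site) : shift t s v = s (v - t) := by
  simp [shift, Finsupp.equivMapDomain_apply, sub_eq_add_neg]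

/-- The unitary on `SpinSpace` that moves the basis vector of `s` to that of `shift t s`. -/
def shiftOp (t : Site) : Op := pull (shift t).symm.toPEquiv

theorem shiftOp_apply (t : Site) (ψ : SpinSpace) (s : Config) :
    shiftOp t ψ s = ψ ((shift t).symm s) := rfl

theorem star_shiftOp_apply (t : Site) (ψ : SpinSpace) (s : Config) :
    star (shiftOp t) ψ s = ψ (shift t s) := by
  rw [shiftOp, star_pull]; rfl

theorem star_shiftOp_mul (t : Site) : star (shiftOp t) * shiftOp t = 1 := by
  ext ψ s
  rw [mul_apply_eq_comp, star_shiftOp_apply, shiftOp_apply]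
  simp

theorem shiftOp_mul_star (t : Site) : shiftOp t * star (shiftOp t) = 1 := by
  ext ψ s
  rw [mul_apply_eq_comp, shiftOp_apply, star_shiftOp_apply]
  simp

/-- Conjugation by the translation unitary. -/
def conjShift (t : Site) : Op →⋆ₐ[ℂ] Op where
  toFun A := shiftOp t * A * star (shiftOp t)
  map_one' := by rw [mul_one, shiftOp_mul_star]
  map_mul' A B := by
    calc shiftOp t * (A * B) * star (shiftOp t)
        = shiftOp t * A * 1 * (B * star (shiftOp t)) := by noncomm_ring
      _ = _ := by rw [← star_shiftOp_mul t]; noncomm_ring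
  map_zero' := by simp
  map_add' A B := by noncomm_ring
  commutes' c := by
    rw [← Algebra.commutes c (shiftOp t), mul_assoc, shiftOp_mul_star, mul_one]
  map_star' A := by simp [mul_assoc]

theorem conjShift_apply (t : Site) (A : Op) :
    conjShift t A = shiftOp t * A * star (shiftOp t) := rfl

/-- The translate of a finite region. -/
def translateRegion (t : Site) (Λ : Finset Site) : Finset Site :=
  Λ.map (Equiv.addRight t).toEmbedding

theorem mem_translateRegion {t : Site} {Λ : Finset Site} {v : Site} (hv : v ∈ Λ) :
    v + t ∈ translateRegion t Λ := by
  simpa [translateRegion] using hv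

theorem sub_mem_of_mem_translateRegion {t : Site} {Λ : Finset Site} {v : Site}
    (hv : v ∈ translateRegion t Λ) : v - t ∈ Λ := by
  simpa [translateRegion, sub_eq_add_neg] using hv

/-- The spins over `Λ` and over `Λ + t` are identified. -/
def regionSpins (t : Site) (Λ : Finset Site) :
    (translateRegion t Λ → Fin 2) ≃ (Λ → Fin 2) where
  toFun x v := x ⟨v.1 + t, mem_translateRegion v.2⟩
  invFun x v := x ⟨v.1 - t, sub_mem_of_mem_translateRegion v.2⟩
  left_inv x := by funext v; simp
  right_inv x := by funext v; simp

/-- A translation moves a local matrix over `Λ` to the same matrix over `Λ + t`. -/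
theorem conjShift_localRep (t : Site) (Λ : Finset Site) (M : LocalMatrix Λ) :
    conjShift t (localRep Λ M) =
      localRep (translateRegion t Λ) (M.submatrix (regionSpins t Λ) (regionSpins t Λ)) := by
  ext ψ s
  rw [conjShift_apply, mul_apply_eq_comp, mul_apply_eq_comp, shiftOp_apply,
    localRep_apply, localRep_apply]
  symm
  refine Fintype.sum_equiv (regionSpins t Λ) _ _ fun y => ?_
  rw [star_shiftOp_apply, Matrix.submatrix_apply]
  have hsymm : ∀ v, (shift t).symm s v = s (v + t) := by
    intro v
    have := shift_apply t ((shift t).symm s) (v + t)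
    simpa using this.symm
  have h1 : (regionSpins t Λ) (restr (translateRegion t Λ) s) = restr Λ ((shift t).symm s) := by
    funext v
    simp [regionSpins, restr, hsymm]
  rw [h1]
  refine congrArg (fun c => M (restr Λ ((shift t).symm s)) (regionSpins t Λ y) * ψ c) ?_
  ext v
  rw [shift_apply, splice_apply, splice_apply, hsymm]
  by_cases hv : v ∈ translateRegion t Λ
  · simp [hv, sub_mem_of_mem_translateRegion hv, regionSpins]
  · have : v - t ∉ Λ := fun h => hv (by simpa using mem_translateRegion (t := t) h)
    simp [hv, this]

theorem conjShift_mem (t : Site) {A : Op} (hA : A ∈ quasiLocal) :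
    conjShift t A ∈ quasiLocal := by
  have hc : Continuous (conjShift t) := by
    change Continuous fun A : Op => shiftOp t * A * star (shiftOp t)
    fun_prop
  have hm : Set.MapsTo (conjShift t) (localObservables : Set Op) (localObservables : Set Op) := by
    intro B hB
    obtain ⟨Λ, M, rfl⟩ := Set.mem_iUnion.1 hB
    exact Set.mem_iUnion.2 ⟨translateRegion t Λ, _, (conjShift_localRep t Λ M).symm⟩
  exact hm.closure hc hA

/-- The translation `τ_t` of the quasi-local algebra. -/
def translate (t : Site) : QLA →⋆ₐ[ℂ] QLA :=
  ((conjShift t).comp quasiLocal.subtype).codRestrict quasiLocal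
    (fun A => conjShift_mem t A.2)

/-! ### The Hamiltonian and the dynamics -/

/-- The stabilizer `K_f`, the tensor product of `σˣ` over the vertices of `f`. -/
def K (f : Face) : QLA := toQLA f.vertices (tensorPower f.vertices pauliX)

/-- The stabilizer `J_f`, the tensor product of `σᶻ` over the vertices of `f`. -/
def J (f : Face) : QLA := toQLA f.vertices (tensorPower f.vertices pauliZ)

/-- The faces all of whose vertices lie in `Λ`. -/
def facesIn (Λ : Finset Site) : Finset Face :=
  (Λ.subtype fun c => Even (c.1 + c.2)).filter fun f => f.vertices ⊆ Λ

theorem mem_facesIn {Λ : Finset Site} {f : Face} : f ∈ facesIn Λ ↔ f.vertices ⊆ Λ := by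
  simp only [facesIn, Finset.mem_filter, Finset.mem_subtype, and_iff_right_iff_imp]
  intro h
  exact h (by simp [Face.vertices])

/-- The Hamiltonian `H_Λ` of a finite region. -/
def hamiltonian (Λ : Finset Site) : QLA := -∑ f ∈ facesIn Λ, K f - ∑ f ∈ facesIn Λ, J f

/-- The generator of the dynamics, `δ(A) = lim_Λ i[H_Λ, A]` as `Λ` exhausts the lattice.
On local `A` the net is eventually constant (`generator_eq`). -/
def generator (A : QLA) : QLA :=
  Filter.limUnder Filter.atTop fun Λ : Finset Site =>
    Complex.I • (hamiltonian Λ * A - A * hamiltonian Λ)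

theorem localRep_commute {Λ₁ Λ₂ : Finset Site} (h : Disjoint Λ₁ Λ₂) (M : LocalMatrix Λ₁)
    (N : LocalMatrix Λ₂) : Commute (localRep Λ₁ M) (localRep Λ₂ N) := by
  have h12 : ∀ v, v ∈ Λ₁ → v ∉ Λ₂ := fun v h1 h2 => Finset.disjoint_left.1 h h1 h2
  have e1 : ∀ x s, restr Λ₁ (splice Λ₂ x s) = restr Λ₁ s := by
    intro x s; funext v; simp [restr, splice_apply, h12 v.1 v.2]
  have e2 : ∀ x s, restr Λ₂ (splice Λ₁ x s) = restr Λ₂ s := by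
    intro x s; funext v
    have : v.1 ∉ Λ₁ := fun h1 => h12 v.1 h1 v.2
    simp [restr, splice_apply, this]
  have e3 : ∀ x y s, splice Λ₁ x (splice Λ₂ y s) = splice Λ₂ y (splice Λ₁ x s) := by
    intro x y s; ext v
    by_cases h1 : v ∈ Λ₁
    · simp [splice_apply, h1, h12 v h1]
    · by_cases h2 : v ∈ Λ₂ <;> simp [splice_apply, h1, h2]
  change _ * _ = _ * _
  ext ψ s
  rw [mul_apply_eq_comp, mul_apply_eq_comp, localRep_apply,
    localRep_apply]
  simp only [localRep_apply, e1, e2, e3, Finset.mul_sum]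
  rw [Finset.sum_comm]
  refine Finset.sum_congr rfl fun y _ => Finset.sum_congr rfl fun x _ => ?_
  ring

/-- The union of `Λ` with all faces that meet it lies in this neighbourhood of `Λ`. -/
def thicken (Λ : Finset Site) : Finset Site :=
  Λ.biUnion fun v => Finset.Icc (v.1 - 2) (v.1 + 2) ×ˢ Finset.Icc (v.2 - 1) (v.2 + 1)

theorem vertices_subset_thicken {f : Face} {Λ : Finset Site} (h : ¬ Disjoint f.vertices Λ) :
    f.vertices ⊆ thicken Λ := by
  obtain ⟨v, hf, hv⟩ := Finset.not_disjoint_iff.1 h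
  intro w hw
  refine Finset.mem_biUnion.2 ⟨v, hv, ?_⟩
  simp only [Face.vertices, Finset.mem_insert, Finset.mem_singleton, Prod.ext_iff] at hf hw
  simp only [Finset.mem_product, Finset.mem_Icc]
  omega

theorem commutator_expand {R ι : Type*} [Ring R] (S : Finset ι) (k j : ι → R) (a : R) :
    (-∑ f ∈ S, k f - ∑ f ∈ S, j f) * a - a * (-∑ f ∈ S, k f - ∑ f ∈ S, j f)
      = -∑ f ∈ S, ((k f * a - a * k f) + (j f * a - a * j f)) := by
  simp only [sub_mul, mul_sub, neg_mul, mul_neg, Finset.sum_mul, Finset.mul_sum,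
    Finset.sum_add_distrib, Finset.sum_sub_distrib]
  abel

theorem toQLA_commutator_eq_zero {Λ Λ' : Finset Site} (hd : Disjoint Λ' Λ) (N : LocalMatrix Λ')
    {A : QLA} (hA : (A : Op) ∈ localAlgebra Λ) : toQLA Λ' N * A - A * toQLA Λ' N = 0 := by
  obtain ⟨M, hM⟩ := hA
  rw [sub_eq_zero]
  apply Subtype.ext
  change localRep Λ' N * (A : Op) = (A : Op) * localRep Λ' N
  rw [← hM]
  exact localRep_commute hd N M

/-- For `A` localized in `Λ`, the generator is the commutator with the Hamiltonian of any finite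
region that contains all faces meeting `Λ`. -/
theorem commutator_eq_of_thicken_subset {Λ Λ' : Finset Site} {A : QLA}
    (hA : (A : Op) ∈ localAlgebra Λ) (h : thicken Λ ⊆ Λ') :
    hamiltonian Λ' * A - A * hamiltonian Λ'
      = hamiltonian (thicken Λ) * A - A * hamiltonian (thicken Λ) := by
  have hsub : facesIn (thicken Λ) ⊆ facesIn Λ' := fun f hf =>
    mem_facesIn.2 ((mem_facesIn.1 hf).trans h)
  have hcomm : ∀ f ∈ facesIn Λ', f ∉ facesIn (thicken Λ) → K f * A - A * K f = 0 ∧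
      J f * A - A * J f = 0 := by
    intro f _ hf
    have hd : Disjoint f.vertices Λ := by
      by_contra hd
      exact hf (mem_facesIn.2 (vertices_subset_thicken hd))
    exact ⟨toQLA_commutator_eq_zero hd _ hA, toQLA_commutator_eq_zero hd _ hA⟩
  rw [hamiltonian, hamiltonian, commutator_expand (facesIn Λ') K J A,
    commutator_expand (facesIn (thicken Λ)) K J A]
  refine congrArg Neg.neg ?_
  symm
  refine Finset.sum_subset hsub fun f hf hf' => ?_
  rw [(hcomm f hf hf').1, (hcomm f hf hf').2, add_zero]

theorem generator_eq {Λ Λ' : Finset Site} {A : QLA} (hA : (A : Op) ∈ localAlgebra Λ)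
    (h : thicken Λ ⊆ Λ') :
    generator A = Complex.I • (hamiltonian Λ' * A - A * hamiltonian Λ') := by
  rw [commutator_eq_of_thicken_subset hA h]
  apply Filter.Tendsto.limUnder_eq
  refine tendsto_const_nhds.congr' ?_
  filter_upwards [Filter.eventually_ge_atTop (thicken Λ)] with Λ'' hΛ
  rw [commutator_eq_of_thicken_subset hA hΛ]

/-! ### States -/

/-- Positivity of a linear functional on the quasi-local algebra. -/
def IsPositive (φ : QLA →ₗ[ℂ] ℂ) : Prop := ∀ A : QLA, 0 ≤ φ (star A * A)

/-- A state: a positive linear functional that is normalized. -/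
def IsState (ω : QLA →ₗ[ℂ] ℂ) : Prop := IsPositive ω ∧ ω 1 = 1

/-- A pure state: a state such that every positive functional majorized by it is a multiple of
it. -/
def IsPureState (ω : QLA →ₗ[ℂ] ℂ) : Prop :=
  IsState ω ∧ ∀ φ : QLA →ₗ[ℂ] ℂ, IsPositive φ → IsPositive (ω - φ) → ∃ c : ℂ, φ = c • ω

/-- A ground state of the color code: a state with `-i ω(A* δ(A)) ≥ 0` for all local `A`. -/
def IsGroundState (ω : QLA →ₗ[ℂ] ℂ) : Prop :=
  IsState ω ∧ ∀ A : QLA, (A : Op) ∈ localObservables →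
    0 ≤ -Complex.I * ω (star A * generator A)

/-- Invariance under all translations of the lattice. -/
def IsTranslationInvariant (ω : QLA →ₗ[ℂ] ℂ) : Prop :=
  ∀ (t : LatticeTranslation) (A : QLA), ω (translate t.1 A) = ω A

end ColorCode

end

/-!
A positive functional that takes the value `φ 1` at a self-adjoint unitary `s` absorbs `s` as a
factor on either side, by the Cauchy–Schwarz inequality. Products of Pauli strings span the local
observables. If every stabilizer has expectation `1`, then a string that anticommutes with some
stabilizer has expectation `0`. All other strings are products of stabilizers, since the code
spanned by the faces is its own dual, and have expectation `1`. So at most one state is stabilized,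
and it is pure, because expectation `1` is extremal. A limit point of the code states of finite sets
of faces is a stabilized state; it minimizes every term of the Hamiltonian, hence is a ground state,
and it is translation invariant by uniqueness.

Conversely, let `ω` be a translation invariant ground state. The upper middle vertex of a face lies
on no other face of the same row or below, so a local operation that measures the stabilizers of one
type and flips the wrong ones there, row by row from below, corrects all faces of a rhombus of `n²`
faces and disturbs only the `2 * n + 1` faces along its upper boundary. The ground state condition
gives `n² * (1 - ω S) ≤ 2 * (2 * n + 1)` for all `n`, whence `ω S = 1` for every stabilizer `S`.
-/

noncomputable section

namespace ColorCode

/-! ### Positive functionals on unital `*`-algebras -/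

section PositiveFunctional

variable {A : Type*} [Ring A] [StarRing A] [Algebra ℂ A] {φ : A →ₗ[ℂ] ℂ}

theorem star_one_sub_mul_one_sub {s : A} (hs : IsSelfAdjoint s) (hs2 : s * s = 1) :
    star (1 - s) * (1 - s) = (2 : ℂ) • (1 - s) := by
  simp only [star_sub, star_one, hs.star_eq, mul_sub, sub_mul, mul_one, one_mul, hs2]
  module

theorem map_star_mul_involution_mul_le {s : A} (hs : IsSelfAdjoint s) (hs2 : s * s = 1)
    (hφ : ∀ a, 0 ≤ φ (star a * a)) (b : A) : φ (star b * (s * b)) ≤ φ (star b * b) := by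
  have expand : φ (star ((1 - s) * b) * ((1 - s) * b))
      = 2 * (φ (star b * b) - φ (star b * (s * b))) := by
    rw [star_mul, mul_assoc, ← mul_assoc (star (1 - s)), star_one_sub_mul_one_sub hs hs2]
    simp only [smul_mul_assoc, mul_smul_comm, map_smul, sub_mul, mul_sub, one_mul, map_sub,
      smul_eq_mul]
  have h := hφ ((1 - s) * b)
  rw [expand] at h
  exact sub_nonneg.1 (le_of_mul_le_mul_left (by rwa [mul_zero]) zero_lt_two)

theorem map_involution_le {s : A} (hs : IsSelfAdjoint s) (hs2 : s * s = 1)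
    (hφ : ∀ a, 0 ≤ φ (star a * a)) : φ s ≤ φ 1 := by
  simpa using map_star_mul_involution_mul_le hs hs2 hφ 1

theorem neg_map_one_le_map_involution {s : A} (hs : IsSelfAdjoint s) (hs2 : s * s = 1)
    (hφ : ∀ a, 0 ≤ φ (star a * a)) : -φ 1 ≤ φ s := by
  have := map_involution_le hs.neg (by rw [neg_mul_neg, hs2]) hφ
  rw [map_neg] at this
  exact neg_le.1 this

/-- The functional `b ↦ ∑ i, φ (V i* b V i)`, the pullback of `φ` along the completely positive map
with Kraus operators `V i`. -/
def krausPullback {ι : Type*} [Fintype ι] (φ : A →ₗ[ℂ] ℂ) (V : ι → A) : A →ₗ[ℂ] ℂ where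
  toFun b := ∑ i, φ (star (V i) * (b * V i))
  map_add' b c := by simp only [add_mul, mul_add, map_add, Finset.sum_add_distrib]
  map_smul' r b := by
    simp only [smul_mul_assoc, mul_smul_comm, map_smul, RingHom.id_apply, Finset.smul_sum]

section Kraus

variable {ι : Type*} [Fintype ι] {V : ι → A}

theorem krausPullback_apply (b : A) :
    krausPullback φ V b = ∑ i, φ (star (V i) * (b * V i)) := rfl

theorem krausPullback_star_mul_self_nonneg (hφ : ∀ a, 0 ≤ φ (star a * a)) (a : A) :
    0 ≤ krausPullback φ V (star a * a) := by
  refine Finset.sum_nonneg fun i _ => ?_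
  rw [mul_assoc, ← mul_assoc, ← star_mul]
  exact hφ (a * V i)

theorem krausPullback_eq_of_mul_eq (hV : ∑ i, star (V i) * V i = 1) {b c : A}
    (h : ∀ i, b * V i = V i * c) : krausPullback φ V b = φ c := by
  simp only [krausPullback_apply, h, ← mul_assoc]
  rw [← map_sum, ← Finset.sum_mul, hV, one_mul]

end Kraus

section StarModule

variable [StarModule ℂ A] (hφ : ∀ a, 0 ≤ φ (star a * a))
include hφ

theorem map_star_of_nonneg (a : A) : φ (star a) = star (φ a) := by
  have him (b : A) : (φ (star b * b)).im = 0 := (Complex.le_def.1 (hφ b)).2.symm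
  have him_one : (φ 1).im = 0 := by simpa only [star_one, mul_one] using him 1
  have polarize (c : ℂ) : φ (star (1 + c • a) * (1 + c • a))
      = φ 1 + c * φ a + star c * φ (star a) + star c * (c * φ (star a * a)) := by
    simp only [star_add, star_one, star_smul, add_mul, mul_add, one_mul, mul_one, smul_mul_assoc,
      mul_smul_comm, map_add, map_smul, smul_eq_mul]
    ring
  have h1 := him (1 + (1 : ℂ) • a)
  have hI := him (1 + Complex.I • a)
  rw [polarize] at h1 hI
  simp only [one_mul, star_one, Complex.add_im, him_one, zero_add, him, add_zero, RCLike.star_def,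
    Complex.conj_I, neg_mul, Complex.mul_im, Complex.I_re, zero_mul, Complex.I_im, Complex.neg_im,
    mul_zero, Complex.mul_re, sub_self, neg_zero] at h1 hI
  apply Complex.ext <;> simp only [Complex.star_def, Complex.conj_re, Complex.conj_im] <;> linarith

/-- The form `⟪a, b⟫ = φ (a* b)` of the Gelfand–Naimark–Segal construction. -/
abbrev gnsCore : PreInnerProductSpace.Core ℂ A where
  inner a b := φ (star a * b)
  conj_inner_symm a b := by
    rw [starRingEnd_apply, ← map_star_of_nonneg hφ, star_mul, star_star]
  re_inner_nonneg a := (Complex.le_def.1 (hφ a)).1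
  add_left a b c := by simp only [star_add, add_mul, map_add]
  smul_left a b r := by
    simp only [star_smul, smul_mul_assoc, map_smul, smul_eq_mul, starRingEnd_apply]

theorem map_mul_eq_zero_of_map_star_mul_self {d : A} (hd : φ (star d * d) = 0) (b : A) :
    φ (b * d) = 0 := by
  let _ := gnsCore hφ
  have cauchy_schwarz : ‖φ (star (star b) * d)‖ * ‖φ (star d * star b)‖
      ≤ (φ (star (star b) * star b)).re * (φ (star d * d)).re :=
    InnerProductSpace.Core.inner_mul_inner_self_le (𝕜 := ℂ) (star b) d
  have norm_comm : ‖φ (star d * star b)‖ = ‖φ (b * d)‖ := by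
    rw [← star_mul, map_star_of_nonneg hφ, norm_star]
  rw [hd, Complex.zero_re, mul_zero, star_star, norm_comm] at cauchy_schwarz
  exact norm_eq_zero.1 (mul_self_eq_zero.1 (cauchy_schwarz.antisymm (mul_self_nonneg _)))

variable {s : A} (hs : IsSelfAdjoint s) (hs2 : s * s = 1) (hone : φ s = φ 1)
include hs hs2 hone

theorem map_mul_involution (b : A) : φ (b * s) = φ b := by
  have hker : φ (star (1 - s) * (1 - s)) = 0 := by
    rw [star_one_sub_mul_one_sub hs hs2, map_smul, map_sub, hone, sub_self, smul_zero]
  have := map_mul_eq_zero_of_map_star_mul_self hφ hker b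
  rw [mul_sub, mul_one, map_sub, sub_eq_zero] at this
  exact this.symm

theorem map_involution_mul (b : A) : φ (s * b) = φ b := by
  rw [← star_star (s * b), star_mul, hs.star_eq, map_star_of_nonneg hφ,
    map_mul_involution hφ hs hs2 hone, ← map_star_of_nonneg hφ, star_star]

theorem map_eq_zero_of_semiconjBy_neg {b : A} (hb : SemiconjBy b s (-s)) : φ b = 0 := by
  have : φ b = -φ b := calc
    φ b = φ (b * s) := (map_mul_involution hφ hs hs2 hone b).symm
    _ = -φ (s * b) := by rw [hb.eq, neg_mul, map_neg]
    _ = -φ b := by rw [map_involution_mul hφ hs hs2 hone]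
  exact self_eq_neg.1 this

end StarModule

end PositiveFunctional

theorem continuous_of_map_star_mul_self_nonneg {A : Type*} [CStarAlgebra A] {φ : A →ₗ[ℂ] ℂ}
    (hφ : ∀ a, 0 ≤ φ (star a * a)) : Continuous φ := by
  let _ := CStarAlgebra.spectralOrder A
  let _ := CStarAlgebra.spectralOrderedRing A
  let ψ : A →ₚ[ℂ] ℂ := PositiveLinearMap.mk₀ φ fun a ha => by
    obtain ⟨b, rfl⟩ := CStarAlgebra.nonneg_iff_eq_star_mul_self.1 ha
    exact hφ b
  obtain ⟨C, hC⟩ := ψ.exists_norm_apply_le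
  exact AddMonoidHomClass.continuous_of_bound φ C hC

theorem IsPositive.continuous {φ : QLA →ₗ[ℂ] ℂ} (hφ : IsPositive φ) : Continuous φ := by
  let _ : CStarAlgebra QLA := StarSubalgebra.cstarAlgebra quasiLocal
    (h_closed := localObservables.isClosed_topologicalClosure)
  exact continuous_of_map_star_mul_self_nonneg (A := QLA) hφ

/-! ### Pauli strings -/

/-- The eigenvalue of `σᶻ` on a spin, as a character of `Fin 2`. -/
def spinSign : AddChar (Fin 2) ℂ where
  toFun x := if x = 0 then 1 else -1
  map_zero_eq_one' := rfl
  map_add_eq_mul' x y := by fin_cases x <;> fin_cases y <;> simp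

theorem spinSign_apply (x : Fin 2) : spinSign x = if x = 0 then 1 else -1 := rfl

theorem spinSign_sum {ι : Type*} (S : Finset ι) (g : ι → Fin 2) :
    spinSign (∑ i ∈ S, g i) = ∏ i ∈ S, spinSign (g i) := by
  classical
  induction S using Finset.induction_on with
  | empty => simp
  | insert i S hi ih => rw [Finset.sum_insert hi, Finset.prod_insert hi, AddChar.map_add_eq_mul, ih]

theorem fin_two_eq_one_of_ne_zero {x : Fin 2} (h : x ≠ 0) : x = 1 := by
  decide +revert

theorem config_add_self (a : Config) : a + a = 0 := by
  ext v
  exact congrArg Fin.val ((by decide : ∀ x : Fin 2, x + x = 0) (a v))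

/-- The pairing of two configurations over the field with two elements: the parity of the number of
sites at which both have spin down. -/
def overlap (a s : Config) : Fin 2 := a.sum fun v x => x * s v

theorem overlap_eq_sum {a : Config} {Λ : Finset Site} (h : a.support ⊆ Λ) (s : Config) :
    overlap a s = ∑ v ∈ Λ, a v * s v :=
  Finsupp.sum_of_support_subset a h _ fun _ _ => zero_mul _

theorem overlap_comm (a s : Config) : overlap a s = overlap s a := by
  classical
  rw [overlap_eq_sum (Finset.subset_union_left (s₂ := s.support)),
    overlap_eq_sum (Finset.subset_union_right (s₁ := a.support))]
  simp only [mul_comm]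

theorem overlap_add_left (a b s : Config) : overlap (a + b) s = overlap a s + overlap b s :=
  Finsupp.sum_add_index' (fun _ => zero_mul _) fun _ _ _ => add_mul _ _ _

theorem overlap_add_right (a s t : Config) : overlap a (s + t) = overlap a s + overlap a t := by
  rw [overlap_comm, overlap_add_left, overlap_comm s, overlap_comm t]

@[simp] theorem overlap_zero_left (s : Config) : overlap 0 s = 0 := Finsupp.sum_zero_index

@[simp] theorem overlap_zero_right (a : Config) : overlap a 0 = 0 := by
  rw [overlap_comm, overlap_zero_left]

/-- The configuration with spins down exactly on `Λ`. -/
def downOn (Λ : Finset Site) : Config := Finsupp.indicator Λ fun _ _ => 1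

theorem downOn_apply (Λ : Finset Site) (v : Site) : downOn Λ v = if v ∈ Λ then 1 else 0 := by
  simp [downOn, Finsupp.indicator_apply]

theorem support_downOn (Λ : Finset Site) : (downOn Λ).support = Λ := by
  ext v
  simp [downOn_apply]

theorem downOn_support (a : Config) : downOn a.support = a := by
  ext v
  by_cases h : a v = 0
  · simp [downOn_apply, h]
  · simp [downOn_apply, fin_two_eq_one_of_ne_zero h]

theorem overlap_downOn (Λ : Finset Site) (s : Config) : overlap (downOn Λ) s = ∑ v ∈ Λ, s v := by
  rw [overlap_eq_sum (support_downOn Λ).subset]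
  refine Finset.sum_congr rfl fun v hv => ?_
  rw [downOn_apply, if_pos hv, one_mul]

/-- The two kinds of Pauli matrices occurring in the stabilizers. -/
inductive PauliType
  | X
  | Z

namespace PauliType

/-- The Pauli matrix of a given type. -/
def matrix : PauliType → Matrix (Fin 2) (Fin 2) ℂ
  | X => pauliX
  | Z => pauliZ

/-- The Pauli type that anticommutes with the given one. -/
def dual : PauliType → PauliType
  | X => Z
  | Z => X

@[simp] theorem dual_dual (P : PauliType) : P.dual.dual = P := by cases P <;> rfl

theorem conjTranspose_matrix (P : PauliType) : P.matrix.conjTranspose = P.matrix := by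
  cases P <;> ext i j <;> fin_cases i <;> fin_cases j <;> simp [matrix, pauliX, pauliZ]

end PauliType

theorem star_tensorPower (Λ : Finset Site) (σ : Matrix (Fin 2) (Fin 2) ℂ) :
    star (tensorPower Λ σ) = tensorPower Λ σ.conjTranspose := by
  ext x y
  simp only [Matrix.star_apply, tensorPower, Matrix.of_apply, star_prod,
    Matrix.conjTranspose_apply]

theorem localRep_tensorPower_apply {σ : Matrix (Fin 2) (Fin 2) ℂ} {c : Fin 2 → ℂ} {d : Fin 2}
    (hσ : ∀ x y, σ x y = if y = x + d then c x else 0) (Λ : Finset Site) (ψ : SpinSpace)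
    (s : Config) : localRep Λ (tensorPower Λ σ) ψ s =
      (∏ v ∈ Λ, c (s v)) * ψ (splice Λ (fun v => s v + d) s) := by
  rw [localRep_apply, Finset.sum_eq_single (fun v : Λ => s v + d)]
  · simp only [tensorPower, Matrix.of_apply, hσ, restr, if_true]
    rw [Finset.prod_coe_sort Λ fun v => c (s v)]
  · intro y _ hy
    obtain ⟨v, hv⟩ := Function.ne_iff.1 hy
    have : tensorPower Λ σ (restr Λ s) y = 0 :=
      Finset.prod_eq_zero (Finset.mem_univ v) (by rw [hσ]; exact if_neg hv)
    rw [this, zero_mul]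
  · exact fun h => absurd (Finset.mem_univ _) h

theorem localRep_tensorPower_pauliX (Λ : Finset Site) (ψ : SpinSpace) (s : Config) :
    localRep Λ (tensorPower Λ pauliX) ψ s = ψ (s + downOn Λ) := by
  have hX : ∀ x y : Fin 2, pauliX x y = if y = x + 1 then 1 else 0 := by
    intro x y
    fin_cases x <;> fin_cases y <;> simp [pauliX]
  have hflip : splice Λ (fun v => s v + 1) s = s + downOn Λ := by
    ext v
    by_cases hv : v ∈ Λ <;> simp [splice_apply, downOn_apply, hv]
  rw [localRep_tensorPower_apply hX, Finset.prod_const_one, one_mul, hflip]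

theorem localRep_tensorPower_pauliZ (Λ : Finset Site) (ψ : SpinSpace) (s : Config) :
    localRep Λ (tensorPower Λ pauliZ) ψ s = spinSign (overlap (downOn Λ) s) * ψ s := by
  have hZ : ∀ x y : Fin 2, pauliZ x y = if y = x + 0 then spinSign x else 0 := by
    intro x y
    fin_cases x <;> fin_cases y <;> simp [pauliZ, spinSign_apply]
  rw [localRep_tensorPower_apply hZ, overlap_downOn, spinSign_sum]
  simp only [add_zero]
  exact congrArg (_ * ψ ·) (splice_restr Λ s)

@[simp] theorem coe_toQLA (Λ : Finset Site) (M : LocalMatrix Λ) :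
    (toQLA Λ M : Op) = localRep Λ M := rfl

theorem coe_mul_apply (A B : QLA) (ψ : SpinSpace) (s : Config) :
    ((A * B : QLA) : Op) ψ s = (A : Op) ((B : Op) ψ) s := rfl

theorem coe_smul_apply (c : ℂ) (A : QLA) (ψ : SpinSpace) (s : Config) :
    ((c • A : QLA) : Op) ψ s = c * (A : Op) ψ s := rfl

theorem coe_sum_apply {ι : Type*} (S : Finset ι) (A : ι → QLA) (ψ : SpinSpace) (s : Config) :
    ((∑ i ∈ S, A i : QLA) : Op) ψ s = ∑ i ∈ S, (A i : Op) ψ s := by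
  rw [AddSubmonoidClass.coe_finsetSum, sum_apply, lp.coeFn_sum, Finset.sum_apply]

theorem quasiLocal_ext {A B : QLA} (h : ∀ ψ s, (A : Op) ψ s = (B : Op) ψ s) : A = B := by
  apply Subtype.ext
  ext ψ s
  exact h ψ s

/-- The Pauli string of type `P` over the support of `a`. -/
def pauli (P : PauliType) (a : Config) : QLA := toQLA a.support (tensorPower a.support P.matrix)

theorem toQLA_tensorPower (P : PauliType) (Λ : Finset Site) :
    toQLA Λ (tensorPower Λ P.matrix) = pauli P (downOn Λ) := by
  rw [pauli, support_downOn]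

theorem pauli_X_apply (a : Config) (ψ : SpinSpace) (s : Config) :
    (pauli .X a : Op) ψ s = ψ (s + a) :=
  (localRep_tensorPower_pauliX a.support ψ s).trans (by rw [downOn_support])

theorem pauli_Z_apply (a : Config) (ψ : SpinSpace) (s : Config) :
    (pauli .Z a : Op) ψ s = spinSign (overlap a s) * ψ s :=
  (localRep_tensorPower_pauliZ a.support ψ s).trans (by rw [downOn_support])

theorem pauli_mul (P : PauliType) (a c : Config) : pauli P a * pauli P c = pauli P (a + c) := by
  refine quasiLocal_ext fun ψ s => ?_
  rw [coe_mul_apply]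
  cases P
  · simp only [pauli_X_apply, add_assoc]
  · simp only [pauli_Z_apply, overlap_add_left, AddChar.map_add_eq_mul, mul_assoc]

@[simp] theorem pauli_zero (P : PauliType) : pauli P 0 = 1 := by
  refine quasiLocal_ext fun ψ s => ?_
  cases P
  · rw [pauli_X_apply, add_zero]; rfl
  · rw [pauli_Z_apply, overlap_zero_left, AddChar.map_zero_eq_one, one_mul]; rfl

theorem pauli_mul_self (P : PauliType) (a : Config) : pauli P a * pauli P a = 1 := by
  rw [pauli_mul, config_add_self, pauli_zero]

theorem isSelfAdjoint_pauli (P : PauliType) (a : Config) : IsSelfAdjoint (pauli P a) := by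
  refine Subtype.ext ?_
  change star (localRep a.support _) = localRep a.support _
  rw [← map_star, star_tensorPower, P.conjTranspose_matrix]

theorem pauli_mem_localObservables (P : PauliType) (a : Config) :
    (pauli P a : Op) ∈ localObservables :=
  Set.mem_iUnion.2 ⟨a.support, _, rfl⟩

theorem commute_pauli (P : PauliType) (a c : Config) : Commute (pauli P a) (pauli P c) := by
  rw [Commute, SemiconjBy, pauli_mul, pauli_mul, add_comm]

theorem pauli_mul_pauli_dual (P : PauliType) (a c : Config) :
    pauli P a * pauli P.dual c = spinSign (overlap a c) • (pauli P.dual c * pauli P a) := by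
  have hXZ (a c : Config) :
      pauli .X a * pauli .Z c = spinSign (overlap a c) • (pauli .Z c * pauli .X a) := by
    refine quasiLocal_ext fun ψ s => ?_
    simp only [coe_mul_apply, coe_smul_apply, pauli_X_apply, pauli_Z_apply, overlap_add_right,
      AddChar.map_add_eq_mul, overlap_comm a c]
    ring
  cases P
  · exact hXZ a c
  · have sign_sq : spinSign (overlap a c) * spinSign (overlap a c) = 1 := by
      rw [spinSign_apply]
      split_ifs <;> norm_num
    change pauli .Z a * pauli .X c = _ • (pauli .X c * pauli .Z a)
    rw [hXZ, smul_smul, overlap_comm c a, sign_sq, one_smul]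

theorem commute_pauli_dual {P : PauliType} {a c : Config} (h : overlap a c = 0) :
    Commute (pauli P a) (pauli P.dual c) := by
  rw [Commute, SemiconjBy, pauli_mul_pauli_dual, h, AddChar.map_zero_eq_one, one_smul]

theorem semiconjBy_pauli_dual_neg {P : PauliType} {a c : Config} (h : overlap a c = 1) :
    SemiconjBy (pauli P a) (pauli P.dual c) (-pauli P.dual c) := by
  rw [SemiconjBy, pauli_mul_pauli_dual, h, neg_mul, spinSign_apply, if_neg one_ne_zero,
    neg_one_smul]

theorem sum_powerset_spinSign_overlap (Λ : Finset Site) (s : Config) :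
    ∑ B ∈ Λ.powerset, spinSign (overlap (downOn B) s)
      = if ∀ v ∈ Λ, s v = 0 then 2 ^ Λ.card else 0 := by
  simp only [overlap_downOn, spinSign_sum]
  rw [← Finset.prod_one_add]
  split_ifs with h
  · rw [Finset.prod_congr rfl fun v hv => by rw [h v hv, AddChar.map_zero_eq_one],
      Finset.prod_const, one_add_one_eq_two]
  · push Not at h
    obtain ⟨v, hv, hsv⟩ := h
    refine Finset.prod_eq_zero hv ?_
    rw [spinSign_apply, if_neg hsv, add_neg_cancel]

/-- The products of a Pauli string of type `σᶻ` and one of type `σˣ`. -/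
def pauliProducts : Set QLA := Set.range fun p : Config × Config => pauli .Z p.1 * pauli .X p.2

theorem localRep_single_apply (Λ : Finset Site) (x y : Λ → Fin 2) (c : ℂ) (ψ : SpinSpace)
    (s : Config) : localRep Λ (Matrix.single x y c) ψ s
      = if x = restr Λ s then c * ψ (splice Λ y s) else 0 := by
  rw [localRep_apply, Finset.sum_eq_single y]
  · simp [Matrix.single_apply]
  · intro z _ hz
    rw [Matrix.single_apply, if_neg fun h => hz h.2.symm, zero_mul]
  · exact fun h => absurd (Finset.mem_univ _) h

/-- The projection onto `x` over `Λ` is the average of the strings of type `σᶻ` inside `Λ`, with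
signs, and a string of type `σˣ` turns `x` into `y`. -/
theorem toQLA_single (Λ : Finset Site) (x y : Λ → Fin 2) (c : ℂ) :
    toQLA Λ (Matrix.single x y c) = (c / 2 ^ Λ.card) • ∑ B ∈ Λ.powerset,
      spinSign (overlap (downOn B) (splice Λ x 0)) •
        (pauli .Z (downOn B) * pauli .X (splice Λ x 0 + splice Λ y 0)) := by
  refine quasiLocal_ext fun ψ s => ?_
  have agree : (∀ v ∈ Λ, (splice Λ x 0 + s) v = 0) ↔ x = restr Λ s := by
    have hfin : ∀ p q : Fin 2, p + q = 0 ↔ p = q := by decide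
    simp +contextual [funext_iff, splice_apply, restr, hfin]
  have moved (h : x = restr Λ s) : s + (splice Λ x 0 + splice Λ y 0) = splice Λ y s := by
    have hcancel : ∀ p q : Fin 2, p + (p + q) = q := by decide
    ext v
    by_cases hv : v ∈ Λ <;> simp [splice_apply, h, hv, restr, hcancel]
  have term (B : Finset Site) : ((spinSign (overlap (downOn B) (splice Λ x 0)) •
        (pauli .Z (downOn B) * pauli .X (splice Λ x 0 + splice Λ y 0)) : QLA) : Op) ψ s
      = spinSign (overlap (downOn B) (splice Λ x 0 + s))
        * ψ (s + (splice Λ x 0 + splice Λ y 0)) := by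
    rw [coe_smul_apply, coe_mul_apply, pauli_Z_apply, pauli_X_apply, overlap_add_right,
      AddChar.map_add_eq_mul, mul_assoc]
  rw [coe_toQLA, localRep_single_apply, coe_smul_apply, coe_sum_apply,
    Finset.sum_congr rfl fun B _ => term B, ← Finset.sum_mul, sum_powerset_spinSign_overlap,
    if_congr agree rfl rfl]
  split_ifs with h
  · rw [moved h, ← mul_assoc, div_mul_cancel₀ _ (pow_ne_zero _ two_ne_zero)]
  · rw [zero_mul, mul_zero]

theorem toQLA_mem_span_pauliProducts (Λ : Finset Site) (M : LocalMatrix Λ) :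
    toQLA Λ M ∈ Submodule.span ℂ pauliProducts := by
  induction M using Matrix.induction_on' with
  | h_zero =>
    have : toQLA Λ 0 = 0 := Subtype.ext (map_zero (localRep Λ))
    exact this ▸ zero_mem _
  | h_add M N hM hN =>
    have : toQLA Λ (M + N) = toQLA Λ M + toQLA Λ N := Subtype.ext (map_add (localRep Λ) M N)
    exact this ▸ add_mem hM hN
  | h_std_basis x y c =>
    rw [toQLA_single]
    exact Submodule.smul_mem _ _ (Submodule.sum_mem _ fun B _ =>
      Submodule.smul_mem _ _ (Submodule.subset_span ⟨(_, _), rfl⟩))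

theorem mem_span_pauliProducts {A : QLA} (hA : (A : Op) ∈ localObservables) :
    A ∈ Submodule.span ℂ pauliProducts := by
  obtain ⟨Λ, M, hM⟩ := Set.mem_iUnion.1 hA
  have : A = toQLA Λ M := Subtype.ext hM.symm
  exact this ▸ toQLA_mem_span_pauliProducts Λ M

/-! ### The face code is self-dual -/

theorem mem_vertices {f : Face} {v : Site} :
    v ∈ f.vertices ↔ (f.1.1 ≤ v.1 ∧ v.1 ≤ f.1.1 + 2) ∧ (f.1.2 ≤ v.2 ∧ v.2 ≤ f.1.2 + 1) := by
  simp only [Face.vertices, Finset.mem_insert, Finset.mem_singleton, Prod.ext_iff]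
  omega

/-- The indicator configuration of a face. -/
def faceConfig (f : Face) : Config := downOn f.vertices

theorem faceConfig_apply (f : Face) (v : Site) :
    faceConfig f v = if v ∈ f.vertices then 1 else 0 :=
  downOn_apply f.vertices v

theorem overlap_faceConfig (f : Face) (a : Config) : overlap (faceConfig f) a =
    a (f.1.1, f.1.2) + a (f.1.1 + 1, f.1.2) + a (f.1.1 + 2, f.1.2) + a (f.1.1, f.1.2 + 1)
      + a (f.1.1 + 1, f.1.2 + 1) + a (f.1.1 + 2, f.1.2 + 1) := by
  rw [faceConfig, overlap_downOn, Face.vertices]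
  repeat rw [Finset.sum_insert (by
    simp only [Finset.mem_insert, Finset.mem_singleton, Prod.ext_iff]; omega)]
  simp only [Finset.sum_singleton, add_assoc]

theorem overlap_faceConfig_faceConfig (f g : Face) :
    overlap (faceConfig f) (faceConfig g) = 0 := by
  obtain ⟨⟨x, y⟩, hf⟩ := f
  obtain ⟨⟨i, j⟩, hg⟩ := g
  obtain ⟨p, rfl⟩ : ∃ p, i = x + p := ⟨i - x, by ring⟩
  obtain ⟨q, rfl⟩ : ∃ q, j = y + q := ⟨j - y, by ring⟩
  have hpq_even : (p + q) % 2 = 0 := by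
    rw [Int.even_iff] at hf hg
    omega
  simp only [overlap_faceConfig, faceConfig_apply, mem_vertices]
  by_cases hpq : (-2 ≤ p ∧ p ≤ 2) ∧ (-1 ≤ q ∧ q ≤ 1)
  · obtain ⟨⟨hp, hp'⟩, hq, hq'⟩ := hpq
    clear hf hg
    interval_cases p <;> interval_cases q <;> simp at hpq_even <;> simp [add_assoc]
  · iterate 6 rw [if_neg (by omega)]
    rfl

/-- The sums of faces of `F`. -/
def faceSpan (F : Set Face) : AddSubgroup Config := AddSubgroup.closure (faceConfig '' F)

theorem faceConfig_mem_faceSpan {F : Set Face} {f : Face} (hf : f ∈ F) :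
    faceConfig f ∈ faceSpan F :=
  AddSubgroup.subset_closure ⟨f, hf, rfl⟩

/-- The configurations that meet every face in an even number of sites; they form the dual of the
code spanned by the faces. -/
def evenConfigs : AddSubgroup Config where
  carrier := {a | ∀ f, overlap (faceConfig f) a = 0}
  zero_mem' _ := overlap_zero_right _
  add_mem' ha hb f := by rw [overlap_add_right, ha f, hb f, add_zero]
  neg_mem' {a} ha := by rwa [neg_eq_of_add_eq_zero_left (config_add_self a)]

theorem mem_evenConfigs {a : Config} : a ∈ evenConfigs ↔ ∀ f, overlap (faceConfig f) a = 0 :=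
  Iff.rfl

theorem faceSpan_le_evenConfigs (F : Set Face) : faceSpan F ≤ evenConfigs := by
  rw [faceSpan, AddSubgroup.closure_le]
  rintro _ ⟨g, -, rfl⟩ f
  exact overlap_faceConfig_faceConfig f g

/-- The upper middle vertex of a face. Being the topmost site of even parity of the face, it lies on
no other face of the same row or below. -/
def topMid (f : Face) : Site := (f.1.1 + 1, f.1.2 + 1)

theorem topMid_mem_vertices {f g : Face} : topMid f ∈ g.vertices ↔
    g = f ∨ g.1 = (f.1.1 - 1, f.1.2 + 1) ∨ g.1 = (f.1.1 + 1, f.1.2 + 1) := by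
  have hf := Int.even_iff.1 f.2
  have hg := Int.even_iff.1 g.2
  simp only [mem_vertices, topMid, Subtype.ext_iff, Prod.ext_iff]
  omega

theorem topMid_mem_vertices_self (f : Face) : topMid f ∈ f.vertices :=
  topMid_mem_vertices.2 (Or.inl rfl)

theorem topMid_mem_vertices_iff_eq {f g : Face} (h : g.1.2 ≤ f.1.2) :
    topMid f ∈ g.vertices ↔ g = f := by
  rw [topMid_mem_vertices, or_iff_left]
  simp only [Prod.ext_iff]
  omega

theorem topMid_injective : Function.Injective topMid := fun f g h => by
  simpa [topMid, Subtype.ext_iff, Prod.ext_iff] using h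

theorem exists_topMid_eq {v : Site} (hv : Even (v.1 + v.2)) : ∃ f, topMid f = v := by
  refine ⟨⟨(v.1 - 1, v.2 - 1), ?_⟩, by simp [topMid]⟩
  rw [Int.even_iff] at hv ⊢
  simp only
  omega

theorem exists_forall_ge_eq_zero {α M : Type*} [Zero M] (a : α →₀ M) (g : α → ℤ) :
    ∃ N, ∀ v, N ≤ g v → a v = 0 := by
  obtain ⟨N, hN⟩ := (a.support.image g).bddAbove
  refine ⟨N + 1, fun v hv => not_not.1 fun hne => ?_⟩
  have := hN (Finset.mem_coe.2 (Finset.mem_image_of_mem g (Finsupp.mem_support_iff.2 hne)))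
  omega

theorem eq_zero_of_three_term_sum_eq_zero {M : Type*} [AddMonoid M] {b : ℤ → M} {N : ℤ}
    (hrec : ∀ i, b i + b (i + 1) + b (i + 2) = 0) (hN : ∀ i, N ≤ i → b i = 0) (i : ℤ) :
    b i = 0 := by
  have down (n : ℕ) : ∀ i, N - n ≤ i → b i = 0 := by
    induction n with
    | zero => simpa using hN
    | succ n ih =>
      intro i hi
      push_cast at hi
      simpa [ih (i + 1) (by omega), ih (i + 2) (by omega)] using hrec i
  exact down (N - i).toNat i (by omega)

theorem eq_zero_of_mem_evenConfigs_of_row {a : Config} (ha : a ∈ evenConfigs) {m : ℤ}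
    (hrow : ∀ v : Site, v.2 ≠ m → a v = 0) : a = 0 := by
  have hrec (i : ℤ) : a (i, m) + a (i + 1, m) + a (i + 2, m) = 0 := by
    rcases Int.even_or_odd (i + m) with hp | hp
    · simpa [overlap_faceConfig, hrow] using ha ⟨(i, m), hp⟩
    · have hp' : Even (i + (m - 1)) := by
        rw [Int.even_iff]
        rw [Int.odd_iff] at hp
        omega
      simpa [overlap_faceConfig, hrow] using ha ⟨(i, m - 1), hp'⟩
  obtain ⟨N, hN⟩ := exists_forall_ge_eq_zero a Prod.fst
  ext v
  by_cases hv : v.2 = m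
  · rw [← Prod.mk.eta (p := v), hv, eq_zero_of_three_term_sum_eq_zero hrec fun i hi => hN (i, m) hi]
    rfl
  · rw [hrow v hv]; rfl

/-- The faces with upper middle vertex in row `m` of `a`. -/
def rowFaces (a : Config) (m : ℤ) : Finset Face :=
  (a.support.filter fun v => v.2 = m).preimage topMid topMid_injective.injOn

theorem mem_rowFaces {a : Config} {m : ℤ} {f : Face} :
    f ∈ rowFaces a m ↔ a (topMid f) ≠ 0 ∧ f.1.2 + 1 = m := by
  simp [rowFaces, topMid]

theorem sum_rowFaces_apply_of_ne {a : Config} {m : ℤ} {v : Site} (h : v.2 < m - 1 ∨ m < v.2) :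
    (∑ f ∈ rowFaces a m, faceConfig f) v = 0 := by
  rw [Finsupp.finsetSum_apply]
  refine Finset.sum_eq_zero fun f hf => ?_
  have := (mem_rowFaces.1 hf).2
  rw [faceConfig_apply, if_neg]
  rw [mem_vertices]
  omega

theorem sum_rowFaces_apply_topMid (a : Config) (g : Face) :
    (∑ f ∈ rowFaces a (g.1.2 + 1), faceConfig f) (topMid g) = a (topMid g) := by
  have term : ∀ f ∈ rowFaces a (g.1.2 + 1),
      faceConfig f (topMid g) = if f = g then 1 else 0 := fun f hf => by
    have hrow := (mem_rowFaces.1 hf).2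
    exact (faceConfig_apply f _).trans (if_congr (topMid_mem_vertices_iff_eq (by omega)) rfl rfl)
  rw [Finsupp.finsetSum_apply, Finset.sum_congr rfl term, Finset.sum_ite_eq']
  by_cases hg : a (topMid g) = 0
  · rw [if_neg fun h => (mem_rowFaces.1 h).1 hg, hg]
  · rw [if_pos (mem_rowFaces.2 ⟨hg, rfl⟩), fin_two_eq_one_of_ne_zero hg]

/-- Adding faces from below clears the even sites of the top row; its odd sites are then clear
because the faces above overlap evenly. -/
theorem exists_faceSpan_clear_top_row {a : Config} (ha : a ∈ evenConfigs) {m : ℤ}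
    (htop : ∀ v : Site, m < v.2 → a v = 0) :
    ∃ s ∈ faceSpan Set.univ, (∀ v : Site, v.2 < m - 1 → s v = 0) ∧
      ∀ v : Site, m ≤ v.2 → (a + s) v = 0 := by
  set s := ∑ f ∈ rowFaces a m, faceConfig f with hs
  have hs_mem : s ∈ faceSpan Set.univ :=
    sum_mem fun f _ => faceConfig_mem_faceSpan (Set.mem_univ f)
  have above (v : Site) (hv : m < v.2) : (a + s) v = 0 := by
    rw [Finsupp.add_apply, htop v hv, sum_rowFaces_apply_of_ne (Or.inr hv), add_zero]
  have even (i : ℤ) (hi : Even (i + m)) : (a + s) (i, m) = 0 := by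
    obtain ⟨f, hf⟩ := exists_topMid_eq (v := (i, m)) hi
    obtain rfl : f.1.2 + 1 = m := congrArg Prod.snd hf
    rw [Finsupp.add_apply, ← hf, hs, sum_rowFaces_apply_topMid, ← Finsupp.add_apply,
      config_add_self, Finsupp.zero_apply]
  have odd (i : ℤ) (hi : Odd (i + m)) : (a + s) (i, m) = 0 := by
    rw [Int.odd_iff] at hi
    have hleft : Even (i - 1 + m) := by rw [Int.even_iff]; omega
    have hright : Even (i - 1 + 2 + m) := by rw [Int.even_iff]; omega
    have clear_above (k : ℤ) : (a + s) (k, m + 1) = 0 := above _ (lt_add_one m)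
    have := add_mem ha (faceSpan_le_evenConfigs _ hs_mem) ⟨(i - 1, m), hleft⟩
    simpa only [overlap_faceConfig, even _ hleft, even _ hright, clear_above, sub_add_cancel,
      zero_add, add_zero] using this
  refine ⟨s, hs_mem, fun v hv => sum_rowFaces_apply_of_ne (Or.inl hv), fun v hv => ?_⟩
  rcases hv.lt_or_eq with hv | rfl
  · exact above v hv
  · exact (Int.even_or_odd (v.1 + v.2)).elim (even v.1) (odd v.1)

theorem mem_faceSpan_of_rows (n : ℕ) (l : ℤ) : ∀ a ∈ evenConfigs,
    (∀ v : Site, v.2 < l ∨ l + n < v.2 → a v = 0) → a ∈ faceSpan Set.univ := by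
  induction n with
  | zero =>
    intro a ha hrows
    rw [eq_zero_of_mem_evenConfigs_of_row ha (m := l) fun v hv =>
      hrows v (by push_cast; omega)]
    exact zero_mem _
  | succ n ih =>
    intro a ha hrows
    push_cast at hrows
    obtain ⟨s, hs, hlow, hclear⟩ :=
      exists_faceSpan_clear_top_row ha (m := l + n + 1) fun v hv => hrows v (by omega)
    have hsum : a + s ∈ faceSpan Set.univ := by
      refine ih _ (add_mem ha (faceSpan_le_evenConfigs _ hs)) fun v hv => ?_
      rcases hv with hv | hv
      · rw [Finsupp.add_apply, hrows v (Or.inl hv), hlow v (by omega), add_zero]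
      · exact hclear v (by omega)
    exact (AddSubgroup.add_mem_cancel_right _ hs).1 hsum

theorem faceSpan_univ : faceSpan Set.univ = evenConfigs := by
  refine le_antisymm (faceSpan_le_evenConfigs _) fun a ha => ?_
  obtain ⟨u, hu⟩ := exists_forall_ge_eq_zero a Prod.snd
  obtain ⟨l, hl⟩ := exists_forall_ge_eq_zero a fun v => -v.2
  refine mem_faceSpan_of_rows (u + l).toNat (-l) a ha fun v hv => ?_
  rcases hv with hv | hv
  · exact hl v (by omega)
  · exact hu v (by omega)

/-! ### The stabilized state is unique -/

/-- The stabilizer of type `P` of a face: `stab .X f` is `K f` and `stab .Z f` is `J f`. -/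
def stab (P : PauliType) (f : Face) : QLA := toQLA f.vertices (tensorPower f.vertices P.matrix)

theorem stab_eq_pauli (P : PauliType) (f : Face) : stab P f = pauli P (faceConfig f) :=
  toQLA_tensorPower P f.vertices

theorem isSelfAdjoint_stab (P : PauliType) (f : Face) : IsSelfAdjoint (stab P f) :=
  stab_eq_pauli P f ▸ isSelfAdjoint_pauli P _

theorem stab_mul_self (P : PauliType) (f : Face) : stab P f * stab P f = 1 :=
  stab_eq_pauli P f ▸ pauli_mul_self P _

/-- A functional is stabilized if its value at every stabilizer is its mass `φ 1`, the largest value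
possible for a positive functional. -/
def IsStabilized (φ : QLA →ₗ[ℂ] ℂ) : Prop := ∀ P f, φ (stab P f) = φ 1

theorem isStabilized_iff {φ : QLA →ₗ[ℂ] ℂ} :
    IsStabilized φ ↔ ∀ f, φ (K f) = φ 1 ∧ φ (J f) = φ 1 :=
  ⟨fun hs f => ⟨hs .X f, hs .Z f⟩, fun hs P f => P.casesOn (hs f).1 (hs f).2⟩

section Uniqueness

variable {φ : QLA →ₗ[ℂ] ℂ}

theorem IsStabilized.map_mul_stab (hs : IsStabilized φ) (hφ : IsPositive φ) (P : PauliType)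
    (f : Face) (A : QLA) : φ (A * stab P f) = φ A :=
  map_mul_involution hφ (isSelfAdjoint_stab P f) (stab_mul_self P f) (hs P f) A

theorem IsStabilized.map_stab_mul (hs : IsStabilized φ) (hφ : IsPositive φ) (P : PauliType)
    (f : Face) (A : QLA) : φ (stab P f * A) = φ A :=
  map_involution_mul hφ (isSelfAdjoint_stab P f) (stab_mul_self P f) (hs P f) A

theorem IsStabilized.map_eq_zero_of_semiconjBy_neg (hs : IsStabilized φ) (hφ : IsPositive φ)
    {P : PauliType} {f : Face} {A : QLA} (hA : SemiconjBy A (stab P f) (-stab P f)) : φ A = 0 :=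
  ColorCode.map_eq_zero_of_semiconjBy_neg hφ (isSelfAdjoint_stab P f) (stab_mul_self P f)
    (hs P f) hA

theorem IsStabilized.map_pauli_mul (hs : IsStabilized φ) (hφ : IsPositive φ) (P : PauliType)
    {a : Config} (ha : a ∈ faceSpan Set.univ) (A : QLA) : φ (pauli P a * A) = φ A := by
  induction ha using AddSubgroup.closure_induction generalizing A with
  | mem a ha =>
    obtain ⟨f, -, rfl⟩ := ha
    rw [← stab_eq_pauli, hs.map_stab_mul hφ]
  | zero => rw [pauli_zero, one_mul]
  | add a c _ _ ha hc => rw [← pauli_mul, mul_assoc, ha, hc]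
  | neg a _ ha => rw [neg_eq_of_add_eq_zero_left (config_add_self a), ha]

theorem exists_semiconjBy_stab_dual_neg (P : PauliType) {a : Config} (ha : a ∉ evenConfigs) :
    ∃ f, SemiconjBy (pauli P a) (stab P.dual f) (-stab P.dual f) := by
  rw [mem_evenConfigs] at ha
  push Not at ha
  obtain ⟨f, hf⟩ := ha
  refine ⟨f, ?_⟩
  rw [stab_eq_pauli]
  exact semiconjBy_pauli_dual_neg (by rw [overlap_comm, fin_two_eq_one_of_ne_zero hf])

theorem commute_pauli_stab (P : PauliType) (a : Config) (f : Face) :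
    Commute (pauli P a) (stab P f) := by
  rw [stab_eq_pauli]
  exact commute_pauli P a _

open Classical in
theorem IsStabilized.map_pauli_mul_pauli_dual (hs : IsStabilized φ) (hφ : IsPositive φ)
    (P : PauliType) (a c : Config) : φ (pauli P a * pauli P.dual c)
      = if a ∈ evenConfigs ∧ c ∈ evenConfigs then φ 1 else 0 := by
  split_ifs with h
  · rw [← faceSpan_univ] at h
    rw [hs.map_pauli_mul hφ _ h.1, ← mul_one (pauli P.dual c), hs.map_pauli_mul hφ _ h.2]
  rcases not_and_or.1 h with ha | hc
  · obtain ⟨f, hf⟩ := exists_semiconjBy_stab_dual_neg P ha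
    exact hs.map_eq_zero_of_semiconjBy_neg hφ (hf.mul_left (commute_pauli_stab P.dual c f))
  · obtain ⟨f, hf⟩ := exists_semiconjBy_stab_dual_neg P.dual hc
    rw [P.dual_dual] at hf
    exact hs.map_eq_zero_of_semiconjBy_neg hφ
      ((commute_pauli_stab P a f).neg_right.semiconjBy.mul_left hf)

theorem dense_localObservables : Dense {A : QLA | (A : Op) ∈ localObservables} := by
  refine Subtype.dense_iff.2 (closure_mono fun B hB => ?_)
  exact ⟨⟨B, localObservables.le_topologicalClosure hB⟩, hB, rfl⟩

theorem IsStabilized.unique {ψ : QLA →ₗ[ℂ] ℂ} (hsφ : IsStabilized φ) (hφ : IsPositive φ)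
    (hψ : IsPositive ψ) (hsψ : IsStabilized ψ) (hmass : φ 1 = ψ 1) : φ = ψ := by
  have on_products : Set.EqOn φ ψ pauliProducts := by
    rintro _ ⟨⟨a, c⟩, rfl⟩
    exact (hsφ.map_pauli_mul_pauli_dual hφ .Z a c).trans
      (hmass ▸ (hsψ.map_pauli_mul_pauli_dual hψ .Z a c).symm)
  have on_local : Set.EqOn φ ψ {A : QLA | (A : Op) ∈ localObservables} := fun A hA =>
    LinearMap.eqOn_span on_products (mem_span_pauliProducts hA)
  exact DFunLike.coe_injective (hφ.continuous.ext_on dense_localObservables hψ.continuous on_local)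

end Uniqueness

/-! ### A stabilized state exists -/

theorem exists_ultrafilter_linearMap_tendsto {𝕜 E F α : Type*} [NormedField 𝕜] [AddCommGroup E]
    [Module 𝕜 E] [NormedAddCommGroup F] [NormedSpace 𝕜 F] [ProperSpace F] (l : Filter α) [l.NeBot]
    (φ : α → E →ₗ[𝕜] F) (hφ : ∀ x, ∃ C, ∀ a, ‖φ a x‖ ≤ C) :
    ∃ (U : Ultrafilter α) (ψ : E →ₗ[𝕜] F), ↑U ≤ l ∧
      ∀ x, Filter.Tendsto (φ · x) U (nhds (ψ x)) := by
  have hlim (x : E) : ∃ y, Filter.Tendsto (φ · x) (Ultrafilter.of l) (nhds y) := by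
    obtain ⟨C, hC⟩ := hφ x
    obtain ⟨y, -, hy⟩ := (isCompact_closedBall (0 : F) C).ultrafilter_le_nhds
      ((Ultrafilter.of l).map (φ · x))
      (Filter.tendsto_principal.2 (.of_forall fun a => mem_closedBall_zero_iff.2 (hC a)))
    exact ⟨y, hy⟩
  choose ψ hψ using hlim
  exact ⟨Ultrafilter.of l, linearMapOfTendsto ψ φ (tendsto_pi_nhds.2 hψ), Ultrafilter.of_le l, hψ⟩

section VectorState

variable {E : Type*} [NormedAddCommGroup E] [InnerProductSpace ℂ E]

/-- The expectation value `⟨ψ, A ψ⟩ / ‖ψ‖²` of the operator `A` in the vector `ψ`. -/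
def vectorState (ψ : E) : (E →L[ℂ] E) →ₗ[ℂ] ℂ where
  toFun A := ((‖ψ‖ : ℂ) ^ 2)⁻¹ * inner ℂ ψ (A ψ)
  map_add' A B := by rw [add_apply, inner_add_right, mul_add]
  map_smul' c A := by
    rw [smul_apply, inner_smul_right, RingHom.id_apply, smul_eq_mul, mul_left_comm]

theorem vectorState_apply (ψ : E) (A : E →L[ℂ] E) :
    vectorState ψ A = ((‖ψ‖ : ℂ) ^ 2)⁻¹ * inner ℂ ψ (A ψ) := rfl

theorem norm_vectorState_le (ψ : E) (A : E →L[ℂ] E) : ‖vectorState ψ A‖ ≤ ‖A‖ := by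
  have hinner : ‖inner ℂ ψ (A ψ)‖ ≤ ‖ψ‖ ^ 2 * ‖A‖ := calc
    ‖inner ℂ ψ (A ψ)‖ ≤ ‖ψ‖ * ‖A ψ‖ := norm_inner_le_norm _ _
    _ ≤ ‖ψ‖ * (‖A‖ * ‖ψ‖) := by gcongr; exact A.le_opNorm ψ
    _ = ‖ψ‖ ^ 2 * ‖A‖ := by ring
  rw [vectorState_apply, norm_mul, norm_inv, norm_pow, Complex.norm_real, norm_norm]
  exact inv_mul_le_of_le_mul₀ (by positivity) (by positivity) hinner

theorem vectorState_star_mul_self_nonneg [CompleteSpace E] (ψ : E) (A : E →L[ℂ] E) :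
    0 ≤ vectorState ψ (star A * A) := by
  rw [vectorState_apply, mul_apply_eq_comp, ContinuousLinearMap.star_eq_adjoint,
    ContinuousLinearMap.adjoint_inner_right, inner_self_eq_norm_sq_to_K]
  norm_cast
  positivity

theorem vectorState_eq_one_of_apply_eq {ψ : E} (hψ : ψ ≠ 0) {A : E →L[ℂ] E} (hA : A ψ = ψ) :
    vectorState ψ A = 1 := by
  rw [vectorState_apply, hA, inner_self_eq_norm_sq_to_K]
  exact inv_mul_cancel₀ (pow_ne_zero 2 (Complex.ofReal_ne_zero.2 (norm_ne_zero_iff.2 hψ)))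

end VectorState

theorem finite_faceSpan (F : Finset Face) : (faceSpan (F : Set Face) : Set Config).Finite := by
  have _ : AddGroup.FG (faceSpan (F : Set Face)) :=
    (AddGroup.fg_iff_addSubgroup_fg _).2
      ((AddSubgroup.fg_iff _).2 ⟨faceConfig '' F, rfl, F.finite_toSet.image _⟩)
  refine AddCommGroup.finite_of_fg_isAddTorsion _ fun a => ?_
  refine isOfFinAddOrder_iff_nsmul_eq_zero.2 ⟨2, two_pos, Subtype.ext ?_⟩
  rw [two_nsmul]
  exact config_add_self a

/-- The superposition of the sums of faces of `F`, a vector fixed by the stabilizers of `F`. -/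
def codeVector (F : Finset Face) : SpinSpace :=
  ∑ s ∈ (finite_faceSpan F).toFinset, lp.single 2 s 1

open Classical in
theorem codeVector_apply (F : Finset Face) (s : Config) :
    codeVector F s = if s ∈ faceSpan (F : Set Face) then 1 else 0 := by
  rw [codeVector, lp.coeFn_sum, Finset.sum_apply]
  simp [Pi.single_apply]

theorem codeVector_ne_zero (F : Finset Face) : codeVector F ≠ 0 := fun h => by
  have h0 := codeVector_apply F 0
  rw [h, if_pos (zero_mem _)] at h0
  exact zero_ne_one h0

theorem stab_codeVector {F : Finset Face} {f : Face} (hf : f ∈ F) (P : PauliType) :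
    (stab P f : Op) (codeVector F) = codeVector F := by
  classical
  ext s
  rw [stab_eq_pauli]
  cases P
  · rw [pauli_X_apply, codeVector_apply, codeVector_apply]
    exact if_congr (AddSubgroup.add_mem_cancel_right _ (faceConfig_mem_faceSpan hf)) rfl rfl
  · rw [pauli_Z_apply, codeVector_apply]
    split_ifs with hs
    · rw [faceSpan_le_evenConfigs _ hs f, AddChar.map_zero_eq_one, one_mul]
    · rw [mul_zero]

theorem exists_isState_isStabilized : ∃ ω : QLA →ₗ[ℂ] ℂ, IsState ω ∧ IsStabilized ω := by
  let φ (F : Finset Face) : QLA →ₗ[ℂ] ℂ :=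
    vectorState (codeVector F) ∘ₗ quasiLocal.subtype.toAlgHom.toLinearMap
  have hbound (A : QLA) : ∃ C, ∀ F, ‖φ F A‖ ≤ C :=
    ⟨‖(A : Op)‖, fun F => norm_vectorState_le _ _⟩
  obtain ⟨U, ω, hU, hω⟩ := exists_ultrafilter_linearMap_tendsto Filter.atTop φ hbound
  have map_eq_one {A : QLA} (G : Finset Face)
      (hA : ∀ F, G ≤ F → (A : Op) (codeVector F) = codeVector F) : ω A = 1 := by
    refine tendsto_nhds_unique (hω A) (tendsto_const_nhds.congr' ?_)
    filter_upwards [hU (Filter.eventually_ge_atTop G)] with F hF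
    exact (vectorState_eq_one_of_apply_eq (codeVector_ne_zero F) (hA F hF)).symm
  have hone : ω 1 = 1 := map_eq_one ∅ fun F _ => rfl
  refine ⟨ω, ⟨fun A => ?_, hone⟩, fun P f => ?_⟩
  · exact ge_of_tendsto' (hω _) fun F => vectorState_star_mul_self_nonneg (codeVector F) (A : Op)
  · rw [hone]
    exact map_eq_one {f} fun F hF => stab_codeVector (Finset.singleton_subset_iff.1 hF) P

/-! ### Properties of the stabilized state -/

section Properties

variable {ω : QLA →ₗ[ℂ] ℂ}

theorem IsPositive.map_stab_le (hω : IsPositive ω) (P : PauliType) (f : Face) :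
    ω (stab P f) ≤ ω 1 :=
  map_involution_le (isSelfAdjoint_stab P f) (stab_mul_self P f) hω

/-- Saturating an upper bound that holds for all positive functionals passes to the summands of a
decomposition into positive functionals. -/
theorem IsStabilized.of_isPositive_sub {φ : QLA →ₗ[ℂ] ℂ} (hs : IsStabilized ω) (hφ : IsPositive φ)
    (hωφ : IsPositive (ω - φ)) : IsStabilized φ := by
  intro P f
  have hsub := hωφ.map_stab_le P f
  rw [LinearMap.sub_apply, LinearMap.sub_apply, hs P f, sub_le_sub_iff_left] at hsub
  exact le_antisymm (hφ.map_stab_le P f) hsub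

theorem IsStabilized.isPureState (hs : IsStabilized ω) (hω : IsState ω) : IsPureState ω := by
  refine ⟨hω, fun φ hφ hωφ => ⟨φ 1, ?_⟩⟩
  have mass_nonneg : 0 ≤ φ 1 := by simpa only [star_one, mul_one] using hφ 1
  refine (hs.of_isPositive_sub hφ hωφ).unique hφ
    (fun A => mul_nonneg mass_nonneg (hω.1 A)) (fun P f => ?_) ?_
  · rw [LinearMap.smul_apply, LinearMap.smul_apply, hs P f]
  · rw [LinearMap.smul_apply, hω.2, smul_eq_mul, mul_one]

theorem hamiltonian_eq_sum_stab (P : PauliType) (Λ : Finset Site) :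
    hamiltonian Λ = -∑ f ∈ facesIn Λ, stab P f - ∑ f ∈ facesIn Λ, stab P.dual f := by
  cases P
  · rfl
  · rw [neg_sub_left, add_comm, ← neg_sub_left]
    rfl

theorem exists_energy_eq_sum {A : QLA} (hA : (A : Op) ∈ localObservables) (G : Finset Face) :
    ∃ F, G ⊆ F ∧ ∀ (P : PauliType) (ω : QLA →ₗ[ℂ] ℂ),
      -Complex.I * ω (star A * generator A) =
        ∑ f ∈ F, (ω (star A * (A * stab P f - stab P f * A))
          + ω (star A * (A * stab P.dual f - stab P.dual f * A))) := by
  classical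
  obtain ⟨Λ, hΛ⟩ := Set.mem_iUnion.1 hA
  obtain ⟨Λ', hΛΛ', hG⟩ : ∃ Λ', thicken Λ ⊆ Λ' ∧ G ⊆ facesIn Λ' :=
    ⟨thicken Λ ∪ G.biUnion Face.vertices, Finset.subset_union_left, fun f hf => mem_facesIn.2
      ((Finset.subset_biUnion_of_mem Face.vertices hf).trans Finset.subset_union_right)⟩
  refine ⟨facesIn Λ', hG, fun P ω => ?_⟩
  have hgen : generator A = Complex.I • ∑ f ∈ facesIn Λ',
      ((A * stab P f - stab P f * A) + (A * stab P.dual f - stab P.dual f * A)) := by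
    rw [generator_eq hΛ hΛΛ', hamiltonian_eq_sum_stab P, commutator_expand,
      ← Finset.sum_neg_distrib]
    simp only [neg_add, neg_sub]
  rw [hgen, mul_smul_comm, map_smul, smul_eq_mul, ← mul_assoc, neg_mul, Complex.I_mul_I, neg_neg,
    one_mul, Finset.mul_sum, map_sum]
  simp only [mul_add, map_add]

theorem IsStabilized.isGroundState (hs : IsStabilized ω) (hω : IsState ω) : IsGroundState ω := by
  refine ⟨hω, fun A hA => ?_⟩
  obtain ⟨F, -, hF⟩ := exists_energy_eq_sum hA ∅
  have term_nonneg (P : PauliType) (f : Face) :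
      0 ≤ ω (star A * (A * stab P f - stab P f * A)) := by
    rw [mul_sub, map_sub, ← mul_assoc, hs.map_mul_stab hω.1, sub_nonneg]
    exact map_star_mul_involution_mul_le (isSelfAdjoint_stab P f) (stab_mul_self P f) hω.1 A
  rw [hF .X]
  exact Finset.sum_nonneg fun f _ => add_nonneg (term_nonneg _ f) (term_nonneg _ f)

theorem translate_tensorPower (t : Site) (Λ : Finset Site) (σ : Matrix (Fin 2) (Fin 2) ℂ) :
    translate t (toQLA Λ (tensorPower Λ σ))
      = toQLA (translateRegion t Λ) (tensorPower (translateRegion t Λ) σ) := by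
  have hsub : (tensorPower Λ σ).submatrix (regionSpins t Λ) (regionSpins t Λ)
      = tensorPower (translateRegion t Λ) σ := by
    ext x y
    simp only [Matrix.submatrix_apply, tensorPower, Matrix.of_apply]
    let e : Λ ≃ translateRegion t Λ :=
      (Equiv.addRight t).subtypeEquiv fun v => by simp [translateRegion]
    exact Fintype.prod_equiv e _ _ fun v => rfl
  exact Subtype.ext ((conjShift_localRep t Λ _).trans (by rw [hsub]; rfl))

/-- The translate of a face. -/
def translateFace (t : LatticeTranslation) (f : Face) : Face :=
  ⟨f.1 + t.1, by
    rw [Prod.fst_add, Prod.snd_add, add_add_add_comm]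
    exact f.2.add t.2⟩

theorem translateRegion_vertices (t : LatticeTranslation) (f : Face) :
    translateRegion t.1 f.vertices = (translateFace t f).vertices := by
  have mem_iff (v : Site) : v ∈ translateRegion t.1 f.vertices ↔ v - t.1 ∈ f.vertices := by
    simp [translateRegion, sub_eq_add_neg]
  ext v
  simp only [mem_iff, mem_vertices, translateFace, Prod.fst_add, Prod.snd_add, Prod.fst_sub,
    Prod.snd_sub]
  omega

theorem translate_stab (t : LatticeTranslation) (P : PauliType) (f : Face) :
    translate t.1 (stab P f) = stab P (translateFace t f) := by
  rw [stab, stab, translate_tensorPower, translateRegion_vertices]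

theorem IsStabilized.isTranslationInvariant (hs : IsStabilized ω) (hω : IsState ω) :
    IsTranslationInvariant ω := by
  intro t
  let φ : QLA →ₗ[ℂ] ℂ := ω ∘ₗ (translate t.1).toAlgHom.toLinearMap
  have map_eq (A : QLA) : φ A = ω (translate t.1 A) := rfl
  have hφ : IsPositive φ := fun A => by
    rw [map_eq, map_mul, map_star]
    exact hω.1 _
  have hsφ : IsStabilized φ := fun P f => by rw [map_eq, map_eq, translate_stab, map_one, hs]
  exact LinearMap.congr_fun (hsφ.unique hφ hω.1 hs (by rw [map_eq, map_one]))

end Properties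

/-! ### Correcting the stabilizers of a finite set of faces -/

section MeasureAndFlip

variable {A : Type*} [Ring A] [Algebra ℂ A]

/-- The Kraus operators that measure the involution `s` and, if the outcome is `-1`, apply `u`. -/
def measureAndFlip (s u : A) : Bool → A
  | true => (2⁻¹ : ℂ) • (1 + s)
  | false => (2⁻¹ : ℂ) • (u * (1 - s))

variable {s u : A}

theorem commute_measureAndFlip {b : A} (hs : Commute b s) (hu : Commute b u) (c : Bool) :
    Commute b (measureAndFlip s u c) := by
  cases c
  · exact (hu.mul_right ((Commute.one_right b).sub_right hs)).smul_right _
  · exact ((Commute.one_right b).add_right hs).smul_right _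

theorem mul_measureAndFlip (hs2 : s * s = 1) (hu : SemiconjBy u s (-s)) (c : Bool) :
    s * measureAndFlip s u c = measureAndFlip s u c := by
  cases c
  · have : s * u = -(u * s) := by rw [hu.eq, neg_mul, neg_neg]
    rw [measureAndFlip, mul_smul_comm, ← mul_assoc, this, neg_mul, mul_assoc, mul_sub, mul_one, hs2,
      ← mul_neg, neg_sub]
  · rw [measureAndFlip, mul_smul_comm, mul_add, mul_one, hs2, add_comm]

theorem sum_star_measureAndFlip_mul_self [StarRing A] [StarModule ℂ A] (hs : IsSelfAdjoint s)
    (hs2 : s * s = 1) (hu : star u * u = 1) :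
    ∑ c, star (measureAndFlip s u c) * measureAndFlip s u c = 1 := by
  have half : star (2⁻¹ : ℂ) * 2⁻¹ = 4⁻¹ := by norm_num
  have hplus : star (1 + s) * (1 + s) = (2 : ℂ) • (1 + s) := by
    simpa using star_one_sub_mul_one_sub hs.neg (by rw [neg_mul_neg, hs2])
  have hminus : star (u * (1 - s)) * (u * (1 - s)) = (2 : ℂ) • (1 - s) := by
    rw [star_mul, mul_assoc, ← mul_assoc (star u), hu, one_mul, star_one_sub_mul_one_sub hs hs2]
  rw [Fintype.sum_bool]
  simp only [measureAndFlip, star_smul, smul_mul_smul_comm, half, hplus, hminus]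
  module

end MeasureAndFlip

/-- The Kraus operators of a local operation that projects all stabilizers of type `P` in `F` onto
`1` and touches no other stabilizer, apart from those of type `P` at the upper middle vertices of
`F`. -/
structure IsCorrection (P : PauliType) (F : Finset Face) {ι : Type} [Fintype ι] (V : ι → QLA) :
    Prop where
  mem_localObservables (i : ι) : (V i : Op) ∈ localObservables
  sum_star_mul_self : ∑ i, star (V i) * V i = 1
  stab_mul {f : Face} (hf : f ∈ F) (i : ι) : stab P f * V i = V i
  commute_stab {g : Face} (hg : ∀ f ∈ F, topMid f ∉ g.vertices) (i : ι) : Commute (stab P g) (V i)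
  commute_stab_dual (g : Face) (i : ι) : Commute (stab P.dual g) (V i)

theorem isCorrection_empty (P : PauliType) : IsCorrection P ∅ fun _ : Unit => 1 where
  mem_localObservables _ := one_mem _
  sum_star_mul_self := by simp
  stab_mul hf := absurd hf (Finset.notMem_empty _)
  commute_stab _ _ := Commute.one_right _
  commute_stab_dual _ _ := Commute.one_right _

open Classical in
theorem IsCorrection.mul {P : PauliType} {E F : Finset Face} {ι κ : Type} [Fintype ι] [Fintype κ]
    {W : κ → QLA} {V : ι → QLA} (hW : IsCorrection P E W) (hV : IsCorrection P F V)
    (hEF : ∀ e ∈ E, ∀ f ∈ F, topMid e ∉ f.vertices) :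
    IsCorrection P (E ∪ F) fun p : κ × ι => W p.1 * V p.2 where
  mem_localObservables p := mul_mem (hW.mem_localObservables p.1) (hV.mem_localObservables p.2)
  sum_star_mul_self := by
    have regroup (k : κ) (i : ι) : star (W k * V i) * (W k * V i)
        = star (V i) * (star (W k) * W k) * V i := by
      simp only [star_mul, mul_assoc]
    simp only [Fintype.sum_prod_type_right, regroup, ← Finset.sum_mul, ← Finset.mul_sum,
      hW.sum_star_mul_self, mul_one, hV.sum_star_mul_self]
  stab_mul {f} hf p := by
    rcases Finset.mem_union.1 hf with hf | hf
    · rw [← mul_assoc, hW.stab_mul hf]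
    · rw [← mul_assoc, (hW.commute_stab (fun e he => hEF e he f hf) p.1).eq, mul_assoc,
        hV.stab_mul hf]
  commute_stab {g} hg p :=
    (hW.commute_stab (fun f hf => hg f (Finset.mem_union_left F hf)) p.1).mul_right
      (hV.commute_stab (fun f hf => hg f (Finset.mem_union_right E hf)) p.2)
  commute_stab_dual g p := (hW.commute_stab_dual g p.1).mul_right (hV.commute_stab_dual g p.2)

/-- The Pauli matrix at the upper middle vertex of `f` that anticommutes with `stab P f`. -/
def flip (P : PauliType) (f : Face) : QLA := pauli P.dual (downOn {topMid f})

theorem overlap_downOn_topMid (f g : Face) :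
    overlap (faceConfig g) (downOn {topMid f}) = if topMid f ∈ g.vertices then 1 else 0 := by
  rw [overlap_comm, overlap_downOn, Finset.sum_singleton, faceConfig_apply]

theorem semiconjBy_flip_stab (P : PauliType) (f : Face) :
    SemiconjBy (flip P f) (stab P f) (-stab P f) := by
  have hanti : SemiconjBy (stab P f) (flip P f) (-flip P f) := by
    rw [stab_eq_pauli]
    refine semiconjBy_pauli_dual_neg ?_
    rw [overlap_downOn_topMid, if_pos (topMid_mem_vertices_self f)]
  rw [SemiconjBy, neg_mul, hanti.eq, neg_mul, neg_neg]

theorem commute_stab_flip (P : PauliType) {f g : Face} (h : topMid f ∉ g.vertices) :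
    Commute (stab P g) (flip P f) := by
  rw [stab_eq_pauli]
  exact commute_pauli_dual (by rw [overlap_downOn_topMid, if_neg h])

theorem isCorrection_measureAndFlip (P : PauliType) (f : Face) :
    IsCorrection P {f} (measureAndFlip (stab P f) (flip P f)) where
  mem_localObservables c := by
    have hS : (stab P f : Op) ∈ localObservables := Set.mem_iUnion.2 ⟨_, _, rfl⟩
    have hU : (flip P f : Op) ∈ localObservables := pauli_mem_localObservables _ _
    cases c
    · exact SMulMemClass.smul_mem _ (mul_mem hU (sub_mem (one_mem _) hS))
    · exact SMulMemClass.smul_mem _ (add_mem (one_mem _) hS)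
  sum_star_mul_self := by
    refine sum_star_measureAndFlip_mul_self (isSelfAdjoint_stab P f) (stab_mul_self P f) ?_
    rw [flip, (isSelfAdjoint_pauli _ _).star_eq, pauli_mul_self]
  stab_mul hg := by
    rw [Finset.mem_singleton.1 hg]
    exact mul_measureAndFlip (stab_mul_self P f) (semiconjBy_flip_stab P f)
  commute_stab {g} hg c := by
    refine commute_measureAndFlip ?_ (commute_stab_flip P (hg f (Finset.mem_singleton_self f))) c
    rw [stab_eq_pauli P g]
    exact commute_pauli_stab P _ f
  commute_stab_dual g c := by
    refine commute_measureAndFlip ?_ (commute_pauli_stab P.dual _ g).symm c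
    rw [stab_eq_pauli, stab_eq_pauli]
    exact (commute_pauli_dual (overlap_faceConfig_faceConfig f g)).symm

/-- Correcting row by row from below, each step spares the faces treated before. -/
theorem exists_isCorrection (P : PauliType) (F : Finset Face) :
    ∃ (ι : Type) (_ : Fintype ι) (V : ι → QLA), IsCorrection P F V := by
  classical
  induction F using Finset.induction_on_max_value (fun f : Face => f.1.2) with
  | empty => exact ⟨Unit, inferInstance, _, isCorrection_empty P⟩
  | insert f F hf hmax ih =>
    obtain ⟨ι, _, V, hV⟩ := ih
    have spared : ∀ e ∈ ({f} : Finset Face), ∀ g ∈ F, topMid e ∉ g.vertices := by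
      intro e he g hg hmem
      rw [Finset.mem_singleton.1 he, topMid_mem_vertices_iff_eq (hmax g hg)] at hmem
      exact hf (hmem ▸ hg)
    exact ⟨Bool × ι, inferInstance, _, (isCorrection_measureAndFlip P f).mul hV spared⟩

/-! ### Translation invariant ground states -/

section GroundState

variable {ω : QLA →ₗ[ℂ] ℂ} {P : PauliType}

theorem IsGroundState.sum_krausPullback_stab_le (hω : IsGroundState ω) {ι : Type*} [Fintype ι]
    {V : ι → QLA} (hloc : ∀ i, (V i : Op) ∈ localObservables) (hV : ∑ i, star (V i) * V i = 1)
    (hdual : ∀ f i, Commute (stab P.dual f) (V i)) {G : Finset Face}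
    (hG : ∀ g ∉ G, ∀ i, Commute (stab P g) (V i)) :
    ∑ f ∈ G, krausPullback ω V (stab P f) ≤ ∑ f ∈ G, ω (stab P f) := by
  have energy_nonneg (i : ι) :
      0 ≤ ∑ f ∈ G, ω (star (V i) * (V i * stab P f - stab P f * V i)) := by
    obtain ⟨F, hGF, hF⟩ := exists_energy_eq_sum (hloc i) G
    have h := hω.2 (V i) (hloc i)
    simp only [hF P, (hdual _ i).eq, sub_self, mul_zero, map_zero, add_zero] at h
    rwa [Finset.sum_subset hGF fun g _ hg => by rw [(hG g hg i).eq, sub_self, mul_zero, map_zero]]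
  have average (f : Face) : ∑ i, ω (star (V i) * (V i * stab P f - stab P f * V i))
      = ω (stab P f) - krausPullback ω V (stab P f) := by
    simp only [mul_sub, map_sub, Finset.sum_sub_distrib, krausPullback_apply, ← mul_assoc]
    rw [← map_sum, ← Finset.sum_mul, hV, one_mul]
  rw [← sub_nonneg, ← Finset.sum_sub_distrib, ← Finset.sum_congr rfl fun f _ => average f,
    Finset.sum_comm]
  exact Finset.sum_nonneg fun i _ => energy_nonneg i

/-- The correction of `F` raises the stabilizers of `F` to `1` and lowers each of the stabilizers
in `G \ F` by at most `2`. -/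
theorem IsGroundState.sum_one_sub_map_stab_le [DecidableEq Face] (hω : IsGroundState ω)
    {F G : Finset Face} (hFG : F ⊆ G) (hG : ∀ f ∈ F, ∀ g, topMid f ∈ g.vertices → g ∈ G) :
    ∑ f ∈ F, (1 - ω (stab P f)) ≤ 2 * (G \ F).card := by
  obtain ⟨ι, _, V, hV⟩ := exists_isCorrection P F
  set φ := krausPullback ω V
  have hφ : IsPositive φ := krausPullback_star_mul_self_nonneg hω.1.1
  have φ_one : φ 1 = 1 := (krausPullback_eq_of_mul_eq hV.sum_star_mul_self fun i => by
    rw [one_mul, mul_one]).trans hω.1.2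
  have inside (f : Face) (hf : f ∈ F) : φ (stab P f) = 1 :=
    (krausPullback_eq_of_mul_eq hV.sum_star_mul_self fun i => by
      rw [hV.stab_mul hf, mul_one]).trans hω.1.2
  have outside (f : Face) : ω (stab P f) - φ (stab P f) ≤ 2 := by
    have upper := hω.1.1.map_stab_le P f
    have lower := neg_map_one_le_map_involution (isSelfAdjoint_stab P f) (stab_mul_self P f) hφ
    rw [hω.1.2] at upper
    rw [φ_one] at lower
    exact (sub_le_sub upper lower).trans_eq (by norm_num)
  have energy : ∑ f ∈ G, φ (stab P f) ≤ ∑ f ∈ G, ω (stab P f) :=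
    hω.sum_krausPullback_stab_le hV.mem_localObservables hV.sum_star_mul_self
      hV.commute_stab_dual fun g hg => hV.commute_stab fun f hf hmem => hg (hG f hf g hmem)
  calc ∑ f ∈ F, (1 - ω (stab P f))
      = ∑ f ∈ F, φ (stab P f) - ∑ f ∈ F, ω (stab P f) := by
        rw [Finset.sum_sub_distrib, Finset.sum_congr rfl inside]
    _ ≤ ∑ f ∈ G \ F, (ω (stab P f) - φ (stab P f)) := by
        rw [Finset.sum_sub_distrib, sub_le_sub_iff, add_comm, Finset.sum_sdiff hFG,
          Finset.sum_sdiff hFG]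
        exact energy
    _ ≤ 2 * (G \ F).card := by
        rw [mul_comm, ← nsmul_eq_mul]
        exact Finset.sum_le_card_nsmul _ _ _ fun f _ => outside f

/-- The faces reached from the face at the origin by the translations `(1, 1)` and `(-1, 1)`. -/
def gridFace : ℕ × ℕ ↪ Face where
  toFun p := ⟨((p.1 : ℤ) - p.2, (p.1 : ℤ) + p.2), by rw [Int.even_iff]; simp only; omega⟩
  inj' p q h := by
    simp only [Subtype.ext_iff, Prod.ext_iff] at h ⊢
    omega

theorem coe_gridFace (p : ℕ × ℕ) : (gridFace p).1 = ((p.1 : ℤ) - p.2, (p.1 : ℤ) + p.2) := rfl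

/-- A rhombus of `n²` faces. -/
def rhombus (n : ℕ) : Finset Face := (Finset.range n ×ˢ Finset.range n).map gridFace

theorem mem_rhombus {n : ℕ} {f : Face} : f ∈ rhombus n ↔ ∃ p < n, ∃ q < n, gridFace (p, q) = f := by
  simp [rhombus, and_assoc]

theorem card_rhombus (n : ℕ) : (rhombus n).card = n * n := by
  rw [rhombus, Finset.card_map, Finset.card_product, Finset.card_range]

theorem rhombus_subset_succ (n : ℕ) : rhombus n ⊆ rhombus (n + 1) := by
  have := Finset.range_mono n.le_succ
  exact Finset.map_subset_map.2 (Finset.product_subset_product this this)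

theorem card_rhombus_succ_sdiff [DecidableEq Face] (n : ℕ) :
    (rhombus (n + 1) \ rhombus n).card = 2 * n + 1 := by
  rw [Finset.card_sdiff_of_subset (rhombus_subset_succ n), card_rhombus, card_rhombus]
  exact Nat.sub_eq_of_eq_add (by ring)

theorem mem_rhombus_succ_of_topMid_mem {n : ℕ} {f g : Face} (hf : f ∈ rhombus n)
    (h : topMid f ∈ g.vertices) : g ∈ rhombus (n + 1) := by
  obtain ⟨p, hp, q, hq, rfl⟩ := mem_rhombus.1 hf
  rcases topMid_mem_vertices.1 h with rfl | hg | hg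
  · exact rhombus_subset_succ n hf
  · refine mem_rhombus.2 ⟨p, by omega, q + 1, by omega, Subtype.ext (hg ▸ ?_)⟩
    simp only [coe_gridFace, Prod.ext_iff]
    omega
  · refine mem_rhombus.2 ⟨p + 1, by omega, q, by omega, Subtype.ext (hg ▸ ?_)⟩
    simp only [coe_gridFace, Prod.ext_iff]
    omega

theorem nonpos_of_forall_sq_mul_le {x : ℝ} (h : ∀ n : ℕ, (n : ℝ) ^ 2 * x ≤ 2 * (2 * n + 1)) :
    x ≤ 0 := by
  by_contra! hx
  obtain ⟨n, hn⟩ := exists_nat_gt (6 / x)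
  have hn_one : (1 : ℝ) ≤ n := by
    exact_mod_cast Nat.one_le_iff_ne_zero.2 fun h0 => by
      rw [h0, Nat.cast_zero] at hn
      exact hn.not_gt (by positivity)
  rw [div_lt_iff₀ hx] at hn
  nlinarith [h n]

theorem IsTranslationInvariant.map_stab_eq (hω : IsTranslationInvariant ω) (P : PauliType)
    (f g : Face) : ω (stab P f) = ω (stab P g) := by
  let t : LatticeTranslation := ⟨g.1 - f.1, by
    rw [Prod.fst_sub, Prod.snd_sub, sub_add_sub_comm]
    exact g.2.sub f.2⟩
  have moved : translateFace t f = g := Subtype.ext (add_sub_cancel f.1 g.1)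
  rw [← moved, ← translate_stab, hω]

theorem IsGroundState.isStabilized (hω : IsGroundState ω) (ht : IsTranslationInvariant ω) :
    IsStabilized ω := by
  classical
  intro P f
  obtain ⟨le_one, im_eq⟩ := Complex.le_def.1 (hω.1.1.map_stab_le P f)
  rw [hω.1.2] at le_one im_eq ⊢
  have defect_le (n : ℕ) : (n : ℝ) ^ 2 * (1 - (ω (stab P f)).re) ≤ 2 * (2 * n + 1) := by
    have h := hω.sum_one_sub_map_stab_le (P := P) (rhombus_subset_succ n)
      fun f hf g hg => mem_rhombus_succ_of_topMid_mem hf hg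
    simp only [ht.map_stab_eq P _ f] at h
    rw [Finset.sum_const, card_rhombus, card_rhombus_succ_sdiff, nsmul_eq_mul] at h
    have hre := (Complex.le_def.1 h).1
    simpa [sq] using hre
  exact Complex.ext (le_antisymm le_one (sub_nonpos.1 (nonpos_of_forall_sq_mul_le defect_le))) im_eq

end GroundState

end ColorCode

end

theorem mainTheorem3 :
    ∃ ω₀ : ColorCode.QLA →ₗ[ℂ] ℂ,
      (ColorCode.IsGroundState ω₀ ∧ ColorCode.IsTranslationInvariant ω₀) ∧
      (∀ ω : ColorCode.QLA →ₗ[ℂ] ℂ,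
        ColorCode.IsGroundState ω → ColorCode.IsTranslationInvariant ω → ω = ω₀) ∧
      (∀ f : ColorCode.Face, ω₀ (ColorCode.K f) = 1 ∧ ω₀ (ColorCode.J f) = 1) ∧
      (∀ ω : ColorCode.QLA →ₗ[ℂ] ℂ, ColorCode.IsState ω →
        (∀ f : ColorCode.Face, ω (ColorCode.K f) = 1 ∧ ω (ColorCode.J f) = 1) → ω = ω₀) ∧
      ColorCode.IsPureState ω₀ := by
  obtain ⟨ω₀, hω₀, hs₀⟩ := ColorCode.exists_isState_isStabilized
  have unique (ω : ColorCode.QLA →ₗ[ℂ] ℂ) (hω : ColorCode.IsState ω)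
      (hs : ColorCode.IsStabilized ω) : ω = ω₀ :=
    hs.unique hω.1 hω₀.1 hs₀ (hω.2.trans hω₀.2.symm)
  refine ⟨ω₀, ⟨hs₀.isGroundState hω₀, hs₀.isTranslationInvariant hω₀⟩,
    fun ω hg ht => unique ω hg.1 (hg.isStabilized ht), ?_, fun ω hω hKJ => unique ω hω ?_,
    hs₀.isPureState hω₀⟩
  · simpa only [hω₀.2] using ColorCode.isStabilized_iff.1 hs₀
  · rwa [ColorCode.isStabilized_iff, hω.2]
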